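/- A *partially ordered pattern* (POP) of size $k$ is a partial order $P$ on the label set $\{1,\dots,k\}$. An occurrence of it in a permutation $\pi=\pi_1\cdots\pi_n$ is a subsequence $\pi_{i_1}\cdots\pi_{i_k}$, $i_1<\dots<i_k$, such that $\pi_{i_j}<\pi_{i_m}$ whenever $j<m$ in $P$; $\pi$ avoids $p$ if it has no occurrence of $p$. Let $\mathfrak S_n(p)$ be the set of permutations of $\{1,\dots,n\}$ avoiding $p$; $p$ and $q$ are *Wilf-equivalent*, $p\sim q$, if $|\mathfrak S_n(p)|=|\mathfrak S_n(q)|$ for all $n\ge 1$. For $\{a,b,c,d\}=\{1,2,3,4\}$ let $(a,b,c;d)$ be the POP of size $4$ that consists of the chain $a>b>c$ and the isolated vertex $d$, and let $(a,b;c,d)$ be the POP of size $4$ that consists of the two disjoint chains $a>b$ and $c>d$ (so $(a,b;c,d)=(c,d;a,b)$). **Type II.** The POPs of size $4$ whose components are a $3$-chain and an isolated vertex are exactly the POPs $(a,b,c;d)$. They form exactly $2$ Wilf-equivalence classes, $d\in\{1,4\}$ and $d\in\{2,3\}$: 1. if $d\in\{1,4\}$, then $|\mathfrak S_n(a,b,c;d)|=\binom{2(n-1)}{n-1}$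 for all $n\ge1$; for $n=1,\dots,8$ this is $1,2,6,20,70,252,924,3432$ (OEIS A000984); 2. if $d\in\{2,3\}$, then $|\mathfrak S_n(a,b,c;d)|=[x^{n+1}]B(x)$ for all $n\ge1$, where $B\in\mathbb Z[[x]]$ is the unique formal power series with $B(0)=0$ and $B(1-B-B^2)=x(1-B^2)$, that is, the compositional inverse of $x(1-x-x^2)/(1-x^2)$ (OEIS A049124); for $n=1,\dots,8$ this is $1,2,6,20,71,264,1015,4002$. **Type III.** The POPs of size $4$ whose components are two $2$-chains are exactly the POPs $(a,b;c,d)$. They form exactly $5$ Wilf-equivalence classes, with the following values of $|\mathfrak S_n(p)|$ for $n=1,\dots,8$: 1. $\{(1,2;4,3),(1,2;3,4),(2,1;3,4),(2,1;4,3)\}$: $1,2,6,18,50,130,322,770$; 2. $\{(1,3;4,2),(3,1;2,4)\}$: $1,2,6,18,52,152,444,1296$; 3. $\{(1,3;2,4),(3,1;4,2)\}$: $1,2,6,18,52,147,413,1159$; 4. $\{(1,4;3,2),(4,1;2,3)\}$: $1,2,6,18,50,134,358,962$; 5. $\{(1,4;2,3),(4,1;3,2)\}$: $1,2,6,18,53,156,460,1357$.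 -/

import Mathlib

/-- A partially ordered pattern of size `k`: a partial order on `k` labelled elements.
The element `i : Fin k` is the vertex with label `i + 1`. The order is wrapped in a structure
so that it is never confused with the usual order of `Fin k`. -/
structure POP (k : ℕ) where
  order : PartialOrder (Fin k)

namespace POP

/-- An occurrence of `p` in `π`: positions `e 0 < e 1 < ⋯ < e (k - 1)` such that
`π (e i) < π (e j)` whenever `i` lies strictly below `j` in `p`. -/
def IsOccurrence {k n : ℕ} (p : POP k) (π : Equiv.Perm (Fin n)) (e : Fin k ↪o Fin n) : Prop :=
  ∀ i j : Fin k, p.order.lt i j → π (e i) < π (e j)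

def Avoids {k n : ℕ} (p : POP k) (π : Equiv.Perm (Fin n)) : Prop :=
  ¬ ∃ e : Fin k ↪o Fin n, p.IsOccurrence π e

/-- The number of permutations of size `n` that avoid `p`. -/
noncomputable def avoidCount {k : ℕ} (p : POP k) (n : ℕ) : ℕ :=
  Nat.card {π : Equiv.Perm (Fin n) // p.Avoids π}

/-- The list of the numbers of permutations of sizes `1, …, 8` that avoid `p`. -/
noncomputable def firstCounts {k : ℕ} (p : POP k) : List ℕ :=
  (List.range 8).map fun i => p.avoidCount (i + 1)

def WilfEquiv {k l : ℕ} (p : POP k) (q : POP l) : Prop :=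
  ∀ n : ℕ, 1 ≤ n → p.avoidCount n = q.avoidCount n

/-- Wilf equivalence as an equivalence relation on the patterns of size `k`. -/
def wilfSetoid (k : ℕ) : Setoid (POP k) where
  r p q := WilfEquiv p q
  iseqv :=
    { refl := fun _ _ _ => rfl
      symm := fun h n hn => (h n hn).symm
      trans := fun h₁ h₂ n hn => (h₁ n hn).trans (h₂ n hn) }

/-- The number of Wilf classes represented in a set of patterns of size `k`. -/
noncomputable def numWilfClasses {k : ℕ} (S : Set (POP k)) : ℕ :=
  (Quotient.mk (wilfSetoid k) '' S).ncard

/-- The pattern `(a, b, c; d)` of size 4: the labels `1, 2, 3, 4` are listed as `a, b, c, d`,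
the vertices labelled `a > b > c` form a chain with top `a`, and the vertex labelled `d`
is isolated. -/
def chainPoint (a b c d : ℕ) (h : [a, b, c, d].Perm [1, 2, 3, 4] := by decide) : POP 4 where
  order :=
    { le x y := x = y ∨ (x.val + 1 = b ∧ y.val + 1 = a) ∨ (x.val + 1 = c ∧ y.val + 1 = b) ∨
        (x.val + 1 = c ∧ y.val + 1 = a)
      lt x y := (x.val + 1 = b ∧ y.val + 1 = a) ∨ (x.val + 1 = c ∧ y.val + 1 = b) ∨
        (x.val + 1 = c ∧ y.val + 1 = a)
      lt_iff_le_not_ge x y := by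
        have hn : [a, b, c, d].Nodup := h.nodup_iff.mpr (by decide)
        simp at hn
        omega
      le_refl x := Or.inl rfl
      le_trans x y z := by
        have hn : [a, b, c, d].Nodup := h.nodup_iff.mpr (by decide)
        simp at hn
        omega
      le_antisymm x y := by
        have hn : [a, b, c, d].Nodup := h.nodup_iff.mpr (by decide)
        simp at hn
        omega }

/-- The pattern `(a, b; c, d)` of size 4: the labels `1, 2, 3, 4` are listed as `a, b, c, d`,
and the only strict relations are `a > b` and `c > d`. -/
def twoChains (a b c d : ℕ) (h : [a, b, c, d].Perm [1, 2, 3, 4] := by decide) : POP 4 where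
  order :=
    { le x y := x = y ∨ (x.val + 1 = b ∧ y.val + 1 = a) ∨ (x.val + 1 = d ∧ y.val + 1 = c)
      lt x y := (x.val + 1 = b ∧ y.val + 1 = a) ∨ (x.val + 1 = d ∧ y.val + 1 = c)
      lt_iff_le_not_ge x y := by
        have hn : [a, b, c, d].Nodup := h.nodup_iff.mpr (by decide)
        simp at hn
        omega
      le_refl x := Or.inl rfl
      le_trans x y z := by
        have hn : [a, b, c, d].Nodup := h.nodup_iff.mpr (by decide)
        simp at hn
        omega
      le_antisymm x y := by
        have hn : [a, b, c, d].Nodup := h.nodup_iff.mpr (by decide)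
        simp at hn
        omega }

/-- The patterns of size 4 whose components are a 3-chain and an isolated vertex. -/
def typeII : Set (POP 4) :=
  {p | Nonempty (@OrderIso (Fin 4) (Fin 3 ⊕ Fin 1) p.order.toLE _)}

/-- The patterns of size 4 whose components are two 2-chains. -/
def typeIII : Set (POP 4) :=
  {p | Nonempty (@OrderIso (Fin 4) (Fin 2 ⊕ Fin 2) p.order.toLE _)}

/-- `B` is the compositional inverse of `x (1 - x - x ^ 2) / (1 - x ^ 2)`, cleared of
denominators. The coefficient of `x ^ (n + 1)` in `B` is the term of A049124 that follows
`n` terms: `1, 1, 2, 6, 20, 71, 264, …` for `n = 0, 1, 2, …`. -/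
def IsRevertSeries (B : PowerSeries ℤ) : Prop :=
  PowerSeries.constantCoeff B = 0 ∧ B * (1 - B - B ^ 2) = PowerSeries.X * (1 - B ^ 2)

end POP

/-! Permutations are grown at the right end: appending a last value and moving up the values from it
on is a bijection, so avoiders of length `n` are the nodes at depth `n` of a tree, counted by
`desc`. A value is alive for a word if appending it creates no occurrence. The work lies in
following the set of alive values along an append and in finding a small label that determines the
subtree.

For a chain and a point, complement and reversal leave `d = 4` and `d = 2` with three chains each.
If `d = 4`, the last value is free, so the count is `n` times the number of permutations of length
`n - 1` avoiding a pattern of length 3. All three trees obey the Catalan rule `catTree`, and `n`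
times the Catalan number is the central binomial coefficient. If `d = 2`, an occurrence is a pattern
of length 3 whose first two places are not adjacent. The last letter cannot yet pair with the next
one, so a bit about it joins the label: the rule is `gapTree` for the orders 123 and 312, and
`midTree` for 231.

The trees are solved by guessing the series of the subtree below a label `k`: it is the `k`-th power
of the Catalan series, or a combination of powers of `A = B / X`. These series satisfy the recursion
of the rule, so induction on the depth identifies coefficients, and the roots of `gapTree` and
`midTree` both read off `B`.

For two chains, the only equivalence that is not a symmetry is between `(1,2;4,3)` and `(1,2;3,4)`.
Until the first inversion the word is increasing; afterwards an ascent, respectively a descent, is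
forbidden among the later letters, and the two trees mirror each other. The five classes are told
apart by their counts at size 6, evaluated in the kernel. -/

namespace POP

open Finset

/-! ### Words grown by appending a value, and the tree they form -/

/-- The value `x` after a new value `v` has been inserted and the values from `v` on moved up. -/
def shift (v x : ℕ) : ℕ := if x < v then x else x + 1

theorem shift_lt_shift {v x y : ℕ} : shift v x < shift v y ↔ x < y := by
  unfold shift; split_ifs <;> omega

theorem shift_lt_self {v x : ℕ} : shift v x < v ↔ x < v := by
  unfold shift; split_ifs <;> omega

theorem self_lt_shift {v x : ℕ} : v < shift v x ↔ v ≤ x := by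
  unfold shift; split_ifs <;> omega

/-- A word of length `n` is a function `f : ℕ → ℕ` read at the places below `n`.
`push n f v` appends `v` to it, moving up the values from `v` on. -/
def push (n : ℕ) (f : ℕ → ℕ) (v i : ℕ) : ℕ :=
  if i < n then shift v (f i) else if i = n then v else 0

theorem push_of_lt {n i : ℕ} (f : ℕ → ℕ) (v : ℕ) (h : i < n) : push n f v i = shift v (f i) :=
  if_pos h

@[simp]
theorem push_self (n : ℕ) (f : ℕ → ℕ) (v : ℕ) : push n f v n = v := by simp [push]

/-- The word of a permutation. -/
def word {n : ℕ} (π : Equiv.Perm (Fin n)) (i : ℕ) : ℕ := if h : i < n then π ⟨i, h⟩ else 0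

theorem word_val {n : ℕ} (π : Equiv.Perm (Fin n)) (i : Fin n) : word π i = π i := by simp [word]

/-- The permutation whose last value is `v` and whose other values are ordered as in `τ`. -/
def append {n : ℕ} (τ : Equiv.Perm (Fin n)) (v : Fin (n + 1)) : Equiv.Perm (Fin (n + 1)) :=
  ((finSuccEquiv' (Fin.last n)).trans τ.optionCongr).trans (finSuccEquiv' v).symm

theorem append_castSucc {n : ℕ} (τ : Equiv.Perm (Fin n)) (v : Fin (n + 1)) (i : Fin n) :
    append τ v i.castSucc = v.succAbove (τ i) := by
  simp [append, finSuccEquiv'_last_apply_castSucc]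

theorem append_last {n : ℕ} (τ : Equiv.Perm (Fin n)) (v : Fin (n + 1)) :
    append τ v (Fin.last n) = v := by
  simp [append]

theorem word_append {n : ℕ} (τ : Equiv.Perm (Fin n)) (v : Fin (n + 1)) :
    word (append τ v) = push n (word τ) v := by
  funext i
  rcases lt_trichotomy i n with h | rfl | h
  · have h1 : (⟨i, by omega⟩ : Fin (n + 1)) = (⟨i, h⟩ : Fin n).castSucc := rfl
    have h2 : i < n + 1 := by omega
    simp only [word, push, h, h2, dif_pos, if_pos, h1, append_castSucc]
    simp only [shift, Fin.succAbove, Fin.lt_def, Fin.val_castSucc]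
    split_ifs <;> simp
  · have h1 : (⟨i, by omega⟩ : Fin (i + 1)) = Fin.last i := rfl
    simp [word, push, h1, append_last]
  · have h2 : ¬ i < n + 1 := by omega
    have h3 : ¬ i < n := by omega
    have h4 : i ≠ n := by omega
    simp [word, push, h2, h3, h4]

theorem append_bijective (n : ℕ) :
    Function.Bijective fun x : Equiv.Perm (Fin n) × Fin (n + 1) => append x.1 x.2 := by
  rw [Fintype.bijective_iff_injective_and_card]
  refine ⟨?_, ?_⟩
  · rintro ⟨τ, v⟩ ⟨τ', v'⟩ h
    have hv : v = v' := by simpa [append_last] using congrArg (fun π => π (Fin.last n)) h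
    subst hv
    have hτ : τ = τ' := by
      ext1 i
      have := congrArg (fun π => π i.castSucc) h
      simpa [append_castSucc] using this
    rw [hτ]
  · simp [Fintype.card_perm, Nat.factorial_succ, mul_comm]

open Classical in
/-- The number of ways to append `d` values one by one to a word of length `n`, where `P n f v`
says that the value `v` may be appended to the word `f` of length `n`. -/
noncomputable def desc (P : ℕ → (ℕ → ℕ) → ℕ → Prop) : ℕ → ℕ → (ℕ → ℕ) → ℕ
  | 0, _, _ => 1
  | d + 1, n, f => ∑ v ∈ range (n + 1) with P n f v, desc P d (n + 1) (push n f v)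

/-- Induction on `d`, splitting off one append through `append_bijective`. The starting length is
arbitrary because the case `d = 1` is needed for patterns that ignore their last place. -/
theorem card_words_add (Av : ℕ → (ℕ → ℕ) → Prop) (P : ℕ → (ℕ → ℕ) → ℕ → Prop)
    (hs : ∀ n f v, Av (n + 1) (push n f v) ↔ Av n f ∧ P n f v) (d n : ℕ)
    [∀ n f, Decidable (Av n f)] :
    Nat.card {π : Equiv.Perm (Fin (n + d)) // Av (n + d) (word π)} =
      ∑ τ : Equiv.Perm (Fin n) with Av n (word τ), desc P d n (word τ) := by
  classical
  induction d generalizing n with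
  | zero => simp [desc, Nat.card_eq_fintype_card, Fintype.card_subtype]
  | succ d ih =>
    have e : n + (d + 1) = n + 1 + d := by omega
    rw [e, ih, sum_filter]
    rw [← (append_bijective n).sum_comp, Fintype.sum_prod_type, sum_filter]
    refine sum_congr rfl fun τ _ => ?_
    simp only [word_append, hs, desc]
    by_cases h : Av n (word τ)
    · simp [h, sum_filter, Finset.sum_range]
    · simp [h]

theorem card_words (Av : ℕ → (ℕ → ℕ) → Prop) (P : ℕ → (ℕ → ℕ) → ℕ → Prop)
    (h0 : ∀ f, Av 0 f) (hs : ∀ n f v, Av (n + 1) (push n f v) ↔ Av n f ∧ P n f v) (n : ℕ) :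
    Nat.card {π : Equiv.Perm (Fin n) // Av n (word π)} = desc P n 0 fun _ => 0 := by
  classical
  have h := card_words_add Av P hs n 0
  rw [Nat.zero_add] at h
  rw [h, filter_true_of_mem fun _ _ => h0 _, Fintype.sum_unique]
  congr 1

/-! ### Pattern avoidance as a condition on appended values -/

/-- A word avoids the relation `R` on places `i < j < k < l`. -/
def Avoid4 (R : ℕ → ℕ → ℕ → ℕ → Prop) (n : ℕ) (f : ℕ → ℕ) : Prop :=
  ¬ ∃ i j k l, i < j ∧ j < k ∧ k < l ∧ l < n ∧ R (f i) (f j) (f k) (f l)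

/-- Appending `v` creates no occurrence of `R`. -/
def Alive4 (R : ℕ → ℕ → ℕ → ℕ → Prop) (n : ℕ) (f : ℕ → ℕ) (v : ℕ) : Prop :=
  ¬ ∃ i j k, i < j ∧ j < k ∧ k < n ∧ R (shift v (f i)) (shift v (f j)) (shift v (f k)) v

/-- An occurrence in the longer word either misses the new place, and then `hR` undoes the shift, or
ends there. -/
theorem avoid4_push {R : ℕ → ℕ → ℕ → ℕ → Prop}
    (hR : ∀ v a b c d, R (shift v a) (shift v b) (shift v c) (shift v d) ↔ R a b c d)
    (n : ℕ) (f : ℕ → ℕ) (v : ℕ) :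
    Avoid4 R (n + 1) (push n f v) ↔ Avoid4 R n f ∧ Alive4 R n f v := by
  unfold Avoid4 Alive4
  rw [← not_or, not_iff_not]
  constructor
  · rintro ⟨i, j, k, l, h1, h2, h3, h4, h⟩
    rw [push_of_lt f v (by omega : i < n), push_of_lt f v (by omega : j < n),
      push_of_lt f v (by omega : k < n)] at h
    rcases Nat.lt_succ_iff_lt_or_eq.1 h4 with h5 | rfl
    · rw [push_of_lt f v h5, hR] at h
      exact Or.inl ⟨i, j, k, l, h1, h2, h3, h5, h⟩
    · rw [push_self] at h
      exact Or.inr ⟨i, j, k, h1, h2, h3, h⟩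
  · rintro (⟨i, j, k, l, h1, h2, h3, h4, h⟩ | ⟨i, j, k, h1, h2, h3, h⟩)
    · refine ⟨i, j, k, l, h1, h2, h3, by omega, ?_⟩
      rwa [push_of_lt f v (by omega : i < n), push_of_lt f v (by omega : j < n),
        push_of_lt f v (by omega : k < n), push_of_lt f v h4, hR]
    · refine ⟨i, j, k, n, h1, h2, h3, by omega, ?_⟩
      rwa [push_of_lt f v (by omega : i < n), push_of_lt f v (by omega : j < n),
        push_of_lt f v (by omega : k < n), push_self]

/-- The values `a, b, c, d`, in this order, are an occurrence of `p`. -/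
def rel (p : POP 4) (a b c d : ℕ) : Prop :=
  ∀ x y : Fin 4, p.order.lt x y → (![a, b, c, d] : Fin 4 → ℕ) x < (![a, b, c, d] : Fin 4 → ℕ) y

theorem rel_shift (p : POP 4) (v a b c d : ℕ) :
    p.rel (shift v a) (shift v b) (shift v c) (shift v d) ↔ p.rel a b c d := by
  have h : (![shift v a, shift v b, shift v c, shift v d] : Fin 4 → ℕ) =
      fun x => shift v ((![a, b, c, d] : Fin 4 → ℕ) x) := by
    funext x; fin_cases x <;> rfl
  simp only [rel, h, shift_lt_shift]

theorem avoids_iff_avoid4 (p : POP 4) {n : ℕ} (π : Equiv.Perm (Fin n)) :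
    p.Avoids π ↔ Avoid4 p.rel n (word π) := by
  unfold Avoids Avoid4
  rw [not_iff_not]
  constructor
  · rintro ⟨e, he⟩
    refine ⟨e 0, e 1, e 2, e 3, ?_, ?_, ?_, (e 3).2, ?_⟩
    · exact e.lt_iff_lt.2 (by decide)
    · exact e.lt_iff_lt.2 (by decide)
    · exact e.lt_iff_lt.2 (by decide)
    · have h : (![word π (e 0), word π (e 1), word π (e 2), word π (e 3)] : Fin 4 → ℕ) =
          fun x => (π (e x) : ℕ) := by
        funext x; fin_cases x <;> simp [word_val]
      intro x y hxy
      rw [h]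
      exact he x y hxy
  · rintro ⟨i, j, k, l, h1, h2, h3, h4, h⟩
    let g : Fin 4 → Fin n := ![⟨i, by omega⟩, ⟨j, by omega⟩, ⟨k, by omega⟩, ⟨l, h4⟩]
    have hg : StrictMono g := by
      rw [Fin.strictMono_iff_lt_succ]
      intro x
      fin_cases x
      · exact h1
      · exact h2
      · exact h3
    refine ⟨OrderEmbedding.ofStrictMono g hg, fun x y hxy => ?_⟩
    have h' := h x y hxy
    have h5 : (![word π i, word π j, word π k, word π l] : Fin 4 → ℕ) =
        fun x => (π (g x) : ℕ) := by
      funext x; fin_cases x <;> simp [g, word, h4, h3.trans h4, h2.trans (h3.trans h4),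
        h1.trans (h2.trans (h3.trans h4))]
    rw [h5] at h'
    exact h'

theorem avoidCount_eq_card (p : POP 4) (n : ℕ) :
    p.avoidCount n = Nat.card {π : Equiv.Perm (Fin n) // Avoid4 p.rel n (word π)} := by
  simp only [avoidCount, avoids_iff_avoid4]

theorem avoidCount_eq_desc (p : POP 4) (n : ℕ) :
    p.avoidCount n = desc (Alive4 p.rel) n 0 fun _ => 0 := by
  rw [avoidCount_eq_card, card_words (Avoid4 p.rel) (Alive4 p.rel)]
  · rintro f ⟨i, j, k, l, -, -, -, h, -⟩
    omega
  · exact avoid4_push p.rel_shift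

/-! ### Patterns of length 3, and patterns of length 4 with a free last place -/

/-- A word avoids the relation `R` on places `i < j < k`. -/
def Avoid3 (R : ℕ → ℕ → ℕ → Prop) (n : ℕ) (f : ℕ → ℕ) : Prop :=
  ¬ ∃ i j k, i < j ∧ j < k ∧ k < n ∧ R (f i) (f j) (f k)

/-- Appending `v` creates no occurrence of `R`. -/
def Alive3 (R : ℕ → ℕ → ℕ → Prop) (n : ℕ) (f : ℕ → ℕ) (v : ℕ) : Prop :=
  ¬ ∃ i j, i < j ∧ j < n ∧ R (shift v (f i)) (shift v (f j)) v

theorem avoid3_push {R : ℕ → ℕ → ℕ → Prop}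
    (hR : ∀ v a b c, R (shift v a) (shift v b) (shift v c) ↔ R a b c)
    (n : ℕ) (f : ℕ → ℕ) (v : ℕ) :
    Avoid3 R (n + 1) (push n f v) ↔ Avoid3 R n f ∧ Alive3 R n f v := by
  unfold Avoid3 Alive3
  rw [← not_or, not_iff_not]
  constructor
  · rintro ⟨i, j, k, h1, h2, h4, h⟩
    rw [push_of_lt f v (by omega : i < n), push_of_lt f v (by omega : j < n)] at h
    rcases Nat.lt_succ_iff_lt_or_eq.1 h4 with h5 | rfl
    · rw [push_of_lt f v h5, hR] at h
      exact Or.inl ⟨i, j, k, h1, h2, h5, h⟩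
    · rw [push_self] at h
      exact Or.inr ⟨i, j, h1, h2, h⟩
  · rintro (⟨i, j, k, h1, h2, h4, h⟩ | ⟨i, j, h1, h2, h⟩)
    · refine ⟨i, j, k, h1, h2, by omega, ?_⟩
      rwa [push_of_lt f v (by omega : i < n), push_of_lt f v (by omega : j < n),
        push_of_lt f v h4, hR]
    · refine ⟨i, j, n, h1, h2, by omega, ?_⟩
      rwa [push_of_lt f v (by omega : i < n), push_of_lt f v (by omega : j < n), push_self]

/-- If `p` ignores its last place, then only the word without its last value matters. -/
theorem avoidCount_succ_of_rel_eq (p : POP 4) (R : ℕ → ℕ → ℕ → Prop)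
    (hR : ∀ v a b c, R (shift v a) (shift v b) (shift v c) ↔ R a b c)
    (hp : ∀ a b c d, p.rel a b c d ↔ R a b c) (n : ℕ) :
    p.avoidCount (n + 1) = (n + 1) * desc (Alive3 R) n 0 fun _ => 0 := by
  classical
  have h3 : ∀ n f v, Alive4 p.rel n f v ↔ Avoid3 R n f := by
    intro n f v
    simp only [Alive4, Avoid3, hp, hR]
  have h43 : ∀ n f, Avoid3 R n f → Avoid4 p.rel n f := by
    rintro n f h ⟨i, j, k, l, h1, h2, h4, h5, h6⟩
    exact h ⟨i, j, k, h1, h2, by omega, (hp _ _ _ _).1 h6⟩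
  have h := card_words_add (Avoid4 p.rel) (Alive4 p.rel) (avoid4_push p.rel_shift) 1 n
  rw [avoidCount_eq_card, h, ← card_words (Avoid3 R) (Alive3 R) (by
    rintro f ⟨i, j, k, -, -, h, -⟩
    omega) (avoid3_push hR), Nat.card_eq_fintype_card, Fintype.card_subtype, card_eq_sum_ones,
    mul_sum, sum_filter, sum_filter]
  refine sum_congr rfl fun τ _ => ?_
  simp only [desc, h3]
  by_cases hτ : Avoid3 R n (word τ)
  · simp [hτ, h43 _ _ hτ]
  · simp [hτ]

/-! ### Complement and reversal -/

/-- Complementing the values of a permutation reverses the order of the pattern. -/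
theorem avoidCount_eq_of_dual {p q : POP 4} (h : ∀ x y, p.order.lt x y ↔ q.order.lt y x) (n : ℕ) :
    p.avoidCount n = q.avoidCount n := by
  refine Nat.card_congr (Equiv.subtypeEquiv (Equiv.mulLeft Fin.revPerm) fun π => ?_)
  simp only [Avoids, IsOccurrence, not_iff_not]
  refine exists_congr fun e => ?_
  rw [forall_comm]
  refine forall₂_congr fun x y => ?_
  simp [h]

/-- Reading a permutation backwards reverses the labels of the pattern. -/
theorem avoidCount_eq_of_rev {p q : POP 4}
    (h : ∀ x y, p.order.lt x y ↔ q.order.lt x.rev y.rev) (n : ℕ) :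
    p.avoidCount n = q.avoidCount n := by
  refine Nat.card_congr (Equiv.subtypeEquiv (Equiv.mulRight Fin.revPerm) fun π => ?_)
  simp only [Avoids, IsOccurrence, not_iff_not]
  let r {k : ℕ} {m : ℕ} (e : Fin k ↪o Fin m) : Fin k ↪o Fin m :=
    OrderEmbedding.ofStrictMono (fun x => (e x.rev).rev) fun x y hxy => by
      simpa using hxy
  have hr {k m : ℕ} (e : Fin k ↪o Fin m) (x : Fin k) : r e x = (e x.rev).rev := rfl
  constructor
  · rintro ⟨e, he⟩
    refine ⟨r e, fun x y hxy => ?_⟩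
    have := he x.rev y.rev ((h _ _).2 (by simpa using hxy))
    simpa [hr] using this
  · rintro ⟨e, he⟩
    refine ⟨r e, fun x y hxy => ?_⟩
    have := he x.rev y.rev ((h _ _).1 hxy)
    simpa [hr] using this

/-! ### Pairs of places at a minimal distance, and the effect of an append -/

/-- The value `u` seen from before the insertion of `v`. -/
def pull (v u : ℕ) : ℕ := if u ≤ v then u else u - 1

theorem shift_lt_iff {v x u : ℕ} : shift v x < u ↔ x < pull v u := by
  unfold shift pull; split_ifs <;> omega

theorem le_shift_iff {v x u : ℕ} : u ≤ shift v x ↔ pull v u ≤ x := by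
  unfold shift pull; split_ifs <;> omega

/-- Some places `i < j < n` at distance at least `g` carry values related to `u` by `Q`. -/
def Occ (Q : ℕ → ℕ → ℕ → Prop) (g n : ℕ) (f : ℕ → ℕ) (u : ℕ) : Prop :=
  ∃ i j, i + g ≤ j ∧ j < n ∧ Q (f i) (f j) u

/-- New pairs end at the appended letter; old pairs see the next value `u` as `pull v u`. With `g =
1` all pairs count, with `g = 2` adjacent ones do not. -/
theorem occ_push {Q : ℕ → ℕ → ℕ → Prop} {g : ℕ} (hg : 1 ≤ g)
    (hQ : ∀ v a b u, Q (shift v a) (shift v b) u ↔ Q a b (pull v u))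
    (n : ℕ) (f : ℕ → ℕ) (v u : ℕ) :
    Occ Q g (n + 1) (push n f v) u ↔
      Occ Q g n f (pull v u) ∨ ∃ i, i + g ≤ n ∧ Q (shift v (f i)) v u := by
  unfold Occ
  constructor
  · rintro ⟨i, j, h1, h2, h⟩
    rw [push_of_lt f v (by omega : i < n)] at h
    rcases Nat.lt_succ_iff_lt_or_eq.1 h2 with h3 | rfl
    · rw [push_of_lt f v h3, hQ] at h
      exact Or.inl ⟨i, j, h1, h3, h⟩
    · rw [push_self] at h
      exact Or.inr ⟨i, h1, h⟩
  · rintro (⟨i, j, h1, h2, h⟩ | ⟨i, h1, h⟩)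
    · exact ⟨i, j, h1, by omega, by
        rwa [push_of_lt f v (by omega : i < n), push_of_lt f v h2, hQ]⟩
    · exact ⟨i, n, h1, by omega, by rwa [push_of_lt f v (by omega : i < n), push_self]⟩

/-- `a`, `b`, `u` are ordered as `1, 2, 3`, where `u` is inserted. -/
def Q123 (a b u : ℕ) : Prop := a < b ∧ b < u

/-- `a`, `b`, `u` are ordered as `3, 1, 2`, where `u` is inserted. -/
def Q312 (a b u : ℕ) : Prop := b < u ∧ u ≤ a

/-- `a`, `b`, `u` are ordered as `2, 3, 1`, where `u` is inserted. -/
def Q231 (a b u : ℕ) : Prop := a < b ∧ u ≤ a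

theorem occ123_push {g : ℕ} (hg : 1 ≤ g) (n : ℕ) (f : ℕ → ℕ) (v u : ℕ) :
    Occ Q123 g (n + 1) (push n f v) u ↔
      Occ Q123 g n f (pull v u) ∨ v < u ∧ ∃ i, i + g ≤ n ∧ f i < v := by
  rw [occ_push hg fun v a b u => by rw [Q123, shift_lt_shift, shift_lt_iff, Q123]]
  simp only [Q123, shift_lt_self]
  grind

theorem occ312_push {g : ℕ} (hg : 1 ≤ g) (n : ℕ) (f : ℕ → ℕ) (v u : ℕ) :
    Occ Q312 g (n + 1) (push n f v) u ↔
      Occ Q312 g n f (pull v u) ∨ v < u ∧ ∃ i, i + g ≤ n ∧ u ≤ f i + 1 := by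
  rw [occ_push hg fun v a b u => by simp only [Q312, shift_lt_iff, le_shift_iff]]
  simp only [Q312, le_shift_iff]
  refine or_congr Iff.rfl ⟨?_, ?_⟩
  · rintro ⟨i, h1, h2, h3⟩
    exact ⟨h2, i, h1, by unfold pull at h3; split_ifs at h3 <;> omega⟩
  · rintro ⟨h2, i, h1, h3⟩
    exact ⟨i, h1, h2, by unfold pull; split_ifs <;> omega⟩

theorem occ231_push {g : ℕ} (hg : 1 ≤ g) (n : ℕ) (f : ℕ → ℕ) (v u : ℕ) :
    Occ Q231 g (n + 1) (push n f v) u ↔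
      Occ Q231 g n f (pull v u) ∨ ∃ i, i + g ≤ n ∧ f i < v ∧ u ≤ f i := by
  rw [occ_push hg fun v a b u => by rw [Q231, shift_lt_shift, le_shift_iff, Q231]]
  simp only [Q231, shift_lt_self]
  refine or_congr Iff.rfl (exists_congr fun i => and_congr_right fun _ => and_congr_right
    fun h => ?_)
  rw [shift, if_pos h]

theorem desc_succ_of_lt {P : ℕ → (ℕ → ℕ) → ℕ → Prop} {n h : ℕ} {f : ℕ → ℕ} (hn : h ≤ n + 1)
    (hP : ∀ v ≤ n, (P n f v ↔ v < h)) (d : ℕ) :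
    desc P (d + 1) n f = ∑ v ∈ range h, desc P d (n + 1) (push n f v) := by
  rw [desc]
  refine sum_congr ?_ fun _ _ => rfl
  ext v
  simp only [mem_filter, mem_range]
  constructor
  · rintro ⟨h1, h2⟩
    exact (hP v (by omega)).1 h2
  · intro h1
    exact ⟨by omega, (hP v (by omega)).2 h1⟩

theorem desc_succ_of_le {P : ℕ → (ℕ → ℕ) → ℕ → Prop} {n m k : ℕ} {f : ℕ → ℕ} (hn : k = n + 1 - m)
    (hP : ∀ v ≤ n, (P n f v ↔ m ≤ v)) (d : ℕ) :
    desc P (d + 1) n f = ∑ t ∈ range k, desc P d (n + 1) (push n f (m + t)) := by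
  classical
  rw [desc]
  symm
  refine sum_bij (fun t _ => m + t) ?_ ?_ ?_ ?_
  · intro t ht
    simp only [mem_filter, mem_range] at ht ⊢
    exact ⟨by omega, (hP _ (by omega)).2 (by omega)⟩
  · intro a _ b _ h
    omega
  · intro v hv
    simp only [mem_filter, mem_range] at hv
    have := (hP v (by omega)).1 hv.2
    exact ⟨v - m, by simp only [mem_range]; omega, by omega⟩
  · intro _ _
    rfl

/-! ### Succession rules for a chain and a point -/

/-- The number of nodes at depth `d` below a node with label `h` of the tree in which a node with
label `h` has children with labels `2, …, h, h + 1`. -/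
def catTree : ℕ → ℕ → ℕ
  | 0, _ => 1
  | d + 1, h => catTree d (h + 1) + ∑ t ∈ range (h - 1), catTree d (t + 2)

/-- The number of nodes at depth `d` below a node of the tree with the rules
`X h → Y (h + 1), X 2, …, X h` and `Y h → Y (h + 1), X (h + 1), X 3, …, X h`; the Boolean is
`true` for `Y`. -/
def gapTree : ℕ → Bool → ℕ → ℕ
  | 0, _, _ => 1
  | d + 1, false, h => gapTree d true (h + 1) + ∑ t ∈ range (h - 1), gapTree d false (t + 2)
  | d + 1, true, h => gapTree d true (h + 1) + gapTree d false (h + 1) +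
      ∑ t ∈ range (h - 2), gapTree d false (t + 3)

/-- The number of nodes at depth `d` below a node of the tree with the rules
`X h → X (h + 1), Y (h + 1), X 2, …, X (h - 1)` and
`Y h → X (h + 1), X h, Y h, X 2, …, X (h - 2)`; the Boolean is `true` for `Y`. -/
def midTree : ℕ → Bool → ℕ → ℕ
  | 0, _, _ => 1
  | d + 1, false, h => midTree d false (h + 1) + midTree d true (h + 1) +
      ∑ t ∈ range (h - 2), midTree d false (t + 2)
  | d + 1, true, h => midTree d false (h + 1) + midTree d false h + midTree d true h +
      ∑ t ∈ range (h - 3), midTree d false (t + 2)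

/-! ### Chains `1 < 2 < 3` -/

/-- The invariant says that a nonempty word contains the value 0; it is vacuous for the empty word.
-/
theorem exists_push_lt {n v : ℕ} {f : ℕ → ℕ} (hv : v ≤ n)
    (hf : ∀ v ≤ n, 0 < v → ∃ i, i < n ∧ f i < v) :
    ∀ u ≤ n + 1, 0 < u → ∃ i, i < n + 1 ∧ push n f v i < u := by
  intro u _ hu
  rcases Nat.eq_zero_or_pos v with rfl | hv0
  · exact ⟨n, by omega, by simpa using hu⟩
  · obtain ⟨i, hi, h⟩ := hf 1 (by omega) (by omega)
    refine ⟨i, by omega, ?_⟩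
    rw [push_of_lt f v hi, shift_lt_iff]
    unfold pull
    split_ifs <;> omega

/-- The alive values are those below `h`. Appending 0 makes no ascent and lifts the bound by one;
appending `v > 0` makes an ascent from the value 0 and kills everything above `v`. -/
theorem desc_123 (d n h : ℕ) (f : ℕ → ℕ) (h1 : 1 ≤ h) (hn : h ≤ n + 1)
    (ha : ∀ v ≤ n, ¬ Occ Q123 1 n f v ↔ v < h) (hf : ∀ v ≤ n, 0 < v → ∃ i, i < n ∧ f i < v) :
    desc (fun n f v => ¬ Occ Q123 1 n f v) d n f = catTree d h := by
  induction d generalizing n h f with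
  | zero => rfl
  | succ d ih =>
    rw [desc_succ_of_lt hn ha]
    obtain ⟨k, rfl⟩ : ∃ k, h = k + 1 := ⟨h - 1, by omega⟩
    rw [sum_range_succ', catTree, add_comm]
    congr 1
    · refine ih _ _ _ (by omega) (by omega) (fun u hu => ?_) (exists_push_lt (by omega) hf)
      rw [occ123_push le_rfl, not_or, ha _ (by unfold pull; split_ifs <;> omega)]
      simp only [Nat.not_lt_zero, and_false, exists_false, not_false_eq_true, and_true]
      unfold pull; split_ifs <;> omega
    · refine sum_congr rfl fun t ht => ?_
      have ht := mem_range.1 ht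
      refine ih _ _ _ (by omega) (by omega) (fun u hu => ?_) (exists_push_lt (by omega) hf)
      have h2 : ∃ i, i + 1 ≤ n ∧ f i < t + 1 := hf (t + 1) (by omega) (by omega)
      rw [occ123_push le_rfl, not_or, ha _ (by unfold pull; split_ifs <;> omega)]
      simp only [h2, and_true]
      unfold pull; split_ifs <;> omega

/-- The least value off the last place is `b.toNat`: the state is `true` when 0 is the last letter.
Appending `v` makes a usable ascent exactly if `b.toNat < v`. -/
theorem desc_123_gap (d n h : ℕ) (f : ℕ → ℕ) (b : Bool) (h1 : 2 ≤ h) (hn : h ≤ n + 1)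
    (ha : ∀ v ≤ n, ¬ Occ Q123 2 n f v ↔ v < h) (hf : ∀ v ≤ n, 0 < v → ∃ i, i < n ∧ f i < v)
    (hb : ∀ v ≤ n, (∃ i, i + 2 ≤ n ∧ f i < v) ↔ b.toNat < v) :
    desc (fun n f v => ¬ Occ Q123 2 n f v) d n f = gapTree d b h := by
  induction d generalizing n h f b with
  | zero => cases b <;> rfl
  | succ d ih =>
    have hX : ∀ v, v ≤ n → 0 < v → ∀ u ≤ n + 1,
        (∃ i, i + 2 ≤ n + 1 ∧ push n f v i < u) ↔ false.toNat < u := by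
      intro v hv hv0 u hu
      simp only [Bool.toNat_false]
      refine ⟨fun ⟨i, _, h⟩ => by omega, fun hu0 => ?_⟩
      obtain ⟨i, hi, h⟩ := hf 1 (by omega) (by omega)
      refine ⟨i, by omega, ?_⟩
      rw [push_of_lt f v hi, shift_lt_iff]
      unfold pull
      split_ifs <;> omega
    have hY : ∀ u ≤ n + 1, (∃ i, i + 2 ≤ n + 1 ∧ push n f 0 i < u) ↔ true.toNat < u := by
      intro u hu
      simp only [Bool.toNat_true]
      constructor
      · rintro ⟨i, hi, h⟩
        rw [push_of_lt f 0 (by omega), shift_lt_iff] at h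
        unfold pull at h
        split_ifs at h <;> omega
      · intro hu1
        obtain ⟨i, hi, h⟩ := hf 1 (by omega) (by omega)
        refine ⟨i, by omega, ?_⟩
        rw [push_of_lt f 0 hi, shift_lt_iff]
        unfold pull
        split_ifs <;> omega
    have hp : ∀ v ≤ n, ∀ u ≤ n + 1, ¬ Occ Q123 2 (n + 1) (push n f v) u ↔
        pull v u < h ∧ ¬ (v < u ∧ b.toNat < v) := by
      intro v hv u hu
      rw [occ123_push (by omega), not_or, ha _ (by unfold pull; split_ifs <;> omega), hb v hv]
    rw [desc_succ_of_lt hn ha]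
    obtain ⟨k, rfl⟩ : ∃ k, h = k + 2 := ⟨h - 2, by omega⟩
    have h0 : desc (fun n f v => ¬ Occ Q123 2 n f v) d (n + 1) (push n f 0) =
        gapTree d true (k + 2 + 1) := by
      refine ih _ _ _ _ (by omega) (by omega) (fun u hu => ?_) (exists_push_lt (by omega) hf) hY
      rw [hp 0 (by omega) u hu]
      unfold pull; split_ifs <;> omega
    have ht : ∀ t, t < k + 1 → b.toNat < t + 1 →
        desc (fun n f v => ¬ Occ Q123 2 n f v) d (n + 1) (push n f (t + 1)) =
        gapTree d false (t + 2) := by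
      intro t ht hbt
      refine ih _ _ _ _ (by omega) (by omega) (fun u hu => ?_) (exists_push_lt (by omega) hf)
        (hX _ (by omega) (by omega))
      rw [hp _ (by omega) u hu]
      unfold pull; split_ifs <;> omega
    rw [sum_range_succ', h0, add_comm]
    cases b with
    | false =>
      rw [gapTree]
      congr 1
      refine sum_congr rfl fun t h => ?_
      exact ht t (mem_range.1 h) (by simp)
    | true =>
      rw [gapTree, sum_range_succ', add_comm (∑ _ ∈ _, _), ← add_assoc]
      refine congrArg₂ (· + ·) (congrArg₂ (· + ·) rfl ?_) (sum_congr rfl fun t h => ?_)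
      -- The value 1 is appended right after 0: its only smaller partner is adjacent, so nothing is
      -- killed and the label still grows.
      · refine ih _ _ _ _ (by omega) (by omega) (fun u hu => ?_) (exists_push_lt (by omega) hf)
          (hX _ (by omega) (by omega))
        rw [hp _ (by omega) u hu]
        simp only [Bool.toNat_true]
        unfold pull; split_ifs <;> omega
      · exact ht (t + 1) (by have := mem_range.1 h; omega) (by simp)

/-! ### Chains `2 < 3`, then `1` -/

/-- The alive values are the `k` values from `m` on. Appending `v` pairs it with the value `v - 1`,
if there is one, and kills everything below `v`. -/
theorem desc_231 (d n m k : ℕ) (f : ℕ → ℕ) (h1 : 1 ≤ k) (hn : m + k = n + 1)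
    (ha : ∀ v ≤ n, ¬ Occ Q231 1 n f v ↔ m ≤ v) (hf : ∀ x < n, ∃ i, i < n ∧ f i = x) :
    desc (fun n f v => ¬ Occ Q231 1 n f v) d n f = catTree d k := by
  induction d generalizing n m k f with
  | zero => rfl
  | succ d ih =>
    have hf' : ∀ v ≤ n, ∀ x < n + 1, ∃ i, i < n + 1 ∧ push n f v i = x := by
      intro v hv x hx
      rcases lt_trichotomy x v with h | rfl | h
      · obtain ⟨i, hi, rfl⟩ := hf x (by omega)
        exact ⟨i, by omega, by rw [push_of_lt f v hi, shift, if_pos h]⟩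
      · exact ⟨n, by omega, push_self n f x⟩
      · obtain ⟨i, hi, h'⟩ := hf (x - 1) (by omega)
        exact ⟨i, by omega, by rw [push_of_lt f v hi, shift, if_neg (by omega)]; omega⟩
    rw [desc_succ_of_le (k := k) (by omega) ha]
    obtain ⟨k, rfl⟩ : ∃ l, k = l + 1 := ⟨k - 1, by omega⟩
    rw [sum_range_succ', catTree, add_comm]
    congr 1
    · refine ih _ m _ _ (by omega) (by omega) (fun u hu => ?_) (hf' _ (by omega))
      rw [occ231_push le_rfl, not_or, ha _ (by unfold pull; split_ifs <;> omega)]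
      constructor
      · rintro ⟨h, -⟩
        unfold pull at h; split_ifs at h <;> omega
      · intro h
        refine ⟨by unfold pull; split_ifs <;> omega, ?_⟩
        rintro ⟨i, -, h3, h4⟩
        omega
    · rw [← sum_range_reflect]
      refine sum_congr rfl fun t ht => ?_
      have ht := mem_range.1 ht
      refine ih _ (m + (k - 1 - t + 1)) _ _ (by omega) (by omega) (fun u hu => ?_) (hf' _ (by omega))
      rw [occ231_push le_rfl, not_or, ha _ (by unfold pull; split_ifs <;> omega)]
      constructor
      · rintro ⟨h, h2⟩
        by_contra hc
        obtain ⟨i, hi, h3⟩ := hf (m + (k - 1 - t)) (by omega)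
        exact h2 ⟨i, by omega, by omega, by omega⟩
      · intro h
        refine ⟨by unfold pull; split_ifs <;> omega, ?_⟩
        rintro ⟨i, -, h3, h4⟩
        omega

/-- The last letter is always the least alive value `m` (state `false`) or the next one (state
`true`). Appending `v` kills the values below `v`, except that for `v = f n + 1` the value `v - 1`
is adjacent and hence unusable, so only those below `f n` die. -/
theorem desc_231_gap (d n m k : ℕ) (f : ℕ → ℕ) (b : Bool) (h1 : 2 + b.toNat ≤ k)
    (hn : m + k = n + 2) (ha : ∀ v ≤ n + 1, ¬ Occ Q231 2 (n + 1) f v ↔ m ≤ v)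
    (hf : ∀ x ≤ n, x ≠ f n → ∃ i, i < n ∧ f i = x) (hl : f n = m + b.toNat)
    (hq : ∀ i < n, f i ≠ f n) :
    desc (fun n f v => ¬ Occ Q231 2 n f v) d (n + 1) f = midTree d b k := by
  induction d generalizing n m k f b with
  | zero => cases b <;> rfl
  | succ d ih =>
    have hf' : ∀ v ≤ n + 1, ∀ x ≤ n + 1, x ≠ push (n + 1) f v (n + 1) →
        ∃ i, i < n + 1 ∧ push (n + 1) f v i = x := by
      intro v hv x hx hxv
      rw [push_self] at hxv
      have hs : ∀ y ≤ n, ∃ i, i < n + 1 ∧ f i = y := by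
        intro y hy
        by_cases hyn : y = f n
        · exact ⟨n, by omega, hyn.symm⟩
        · obtain ⟨i, hi, h⟩ := hf y hy hyn
          exact ⟨i, by omega, h⟩
      rcases lt_or_gt_of_ne hxv with h | h
      · obtain ⟨i, hi, rfl⟩ := hs x (by omega)
        exact ⟨i, by omega, by rw [push_of_lt f v hi, shift, if_pos h]⟩
      · obtain ⟨i, hi, h'⟩ := hs (x - 1) (by omega)
        exact ⟨i, by omega, by rw [push_of_lt f v hi, shift, if_neg (by omega)]; omega⟩
    have hq' : ∀ v, ∀ i < n + 1, push (n + 1) f v i ≠ push (n + 1) f v (n + 1) := by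
      intro v i hi
      rw [push_self, push_of_lt f v hi, shift]
      split_ifs <;> omega
    have hp : ∀ v, m ≤ v → v ≤ n + 1 → ∀ u ≤ n + 2,
        ¬ Occ Q231 2 (n + 2) (push (n + 1) f v) u ↔
          m ≤ u ∧ (if f n + 1 = v then f n else v) ≤ u := by
      intro v hmv hv u hu
      rw [occ231_push (by omega), not_or, ha _ (by unfold pull; split_ifs <;> omega)]
      constructor
      · rintro ⟨h, h2⟩
        have hmu : m ≤ u := by unfold pull at h; split_ifs at h <;> omega
        refine ⟨hmu, ?_⟩
        by_contra hc
        -- The witness is the largest value below `v` that is not the last letter.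
        split_ifs at hc with hv1
        · obtain ⟨i, hi, h3⟩ := hf (f n - 1) (by omega) (by omega)
          exact h2 ⟨i, by omega, by omega, by omega⟩
        · obtain ⟨i, hi, h3⟩ := hf (v - 1) (by omega) (by omega)
          exact h2 ⟨i, by omega, by omega, by omega⟩
      · rintro ⟨h, h2⟩
        refine ⟨by unfold pull; split_ifs <;> omega, ?_⟩
        rintro ⟨i, hi, h3, h4⟩
        have := hq i (by omega)
        split_ifs at h2 <;> omega
    have hc : ∀ t m' k' b', t < k → 2 + b'.toNat ≤ k' → m' + k' = n + 3 →
        m + t = m' + b'.toNat →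
        (∀ u, m ≤ u ∧ (if f n + 1 = m + t then f n else m + t) ≤ u ↔ m' ≤ u) →
        desc (fun n f v => ¬ Occ Q231 2 n f v) d (n + 1 + 1) (push (n + 1) f (m + t)) =
          midTree d b' k' := by
      intro t m' k' b' ht hk' hm' hmt hu
      refine ih (n + 1) m' k' _ b' hk' (by omega) (fun u hun => ?_) (hf' _ (by omega))
        (by rw [push_self, hmt]) (hq' _)
      rw [hp _ (by omega) (by omega) u (by omega), hu]
    rw [desc_succ_of_le (k := k) (by omega) ha]
    cases b with
    | false =>
      simp only [Bool.toNat_false, add_zero] at hl h1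
      obtain ⟨k, rfl⟩ : ∃ l, k = l + 2 := ⟨k - 2, by omega⟩
      rw [sum_range_succ', sum_range_succ', midTree,
        hc 0 m (k + 2 + 1) false (by omega) (by simp) (by omega) (by simp)
          (fun u => by split_ifs <;> omega),
        hc (0 + 1) m (k + 2 + 1) true (by omega) (by simp) (by omega) (by simp)
          (fun u => by split_ifs <;> omega),
        ← sum_range_reflect]
      have hs : ∑ j ∈ range k, desc (fun n f v => ¬ Occ Q231 2 n f v) d (n + 1 + 1)
            (push (n + 1) f (m + (k - 1 - j + 1 + 1))) =
          ∑ t ∈ range (k + 2 - 2), midTree d false (t + 2) := by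
        refine sum_congr rfl fun t ht => ?_
        have ht := mem_range.1 ht
        exact hc _ (m + (k - 1 - t + 1 + 1)) _ _ (by omega) (by simp) (by omega) (by simp)
          (fun u => by split_ifs <;> omega)
      rw [hs]
      ring
    | true =>
      simp only [Bool.toNat_true] at hl h1
      obtain ⟨k, rfl⟩ : ∃ l, k = l + 3 := ⟨k - 3, by omega⟩
      rw [sum_range_succ', sum_range_succ', sum_range_succ', midTree,
        hc 0 m (k + 3 + 1) false (by omega) (by simp) (by omega) (by simp)
          (fun u => by split_ifs <;> omega),
        hc (0 + 1) (m + 1) (k + 3) false (by omega) (by simp) (by omega) (by simp)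
          (fun u => by split_ifs <;> omega),
        hc (0 + 1 + 1) (m + 1) (k + 3) true (by omega) (by simp) (by omega) (by simp)
          (fun u => by split_ifs <;> omega),
        ← sum_range_reflect]
      have hs : ∑ j ∈ range k, desc (fun n f v => ¬ Occ Q231 2 n f v) d (n + 1 + 1)
            (push (n + 1) f (m + (k - 1 - j + 1 + 1 + 1))) =
          ∑ t ∈ range (k + 3 - 3), midTree d false (t + 2) := by
        refine sum_congr rfl fun t ht => ?_
        have ht := mem_range.1 ht
        exact hc _ (m + (k - 1 - t + 1 + 1 + 1)) _ _ (by omega) (by simp) (by omega) (by simp)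
          (fun u => by split_ifs <;> omega)
      rw [hs]
      ring

/-! ### `3`, then the chain `1 < 2` -/

/-- For the order 312 the alive values need not form an interval; a child depends only on the rank
of the appended value among them. -/
theorem sum_rank {M : Type*} [AddCommMonoid M] (S : Finset ℕ) (g : ℕ → M) :
    ∑ v ∈ S, g #{u ∈ S | u ≤ v} = ∑ t ∈ range #S, g (t + 1) := by
  induction S using Finset.induction_on_max with
  | empty => simp
  | insert a S hS ih =>
    have haS : a ∉ S := fun h => lt_irrefl _ (hS a h)
    rw [sum_insert haS, card_insert_of_notMem haS, sum_range_succ, ← ih, add_comm]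
    congr 1
    · refine sum_congr rfl fun v hv => ?_
      rw [filter_insert, if_neg (not_le.2 (hS v hv))]
    · rw [filter_true_of_mem, card_insert_of_notMem haS]
      intro u hu
      rcases mem_insert.1 hu with rfl | h
      · exact le_rfl
      · exact (hS u h).le

/-- The sum over all elements of `S` but the last, `n`, of a function of the rank. -/
theorem sum_erase_rank {M : Type*} [AddCommMonoid M] {S : Finset ℕ} {n : ℕ} (hS : ∀ v ∈ S, v ≤ n)
    (hn : n ∈ S) (g : ℕ → M) :
    ∑ v ∈ S.erase n, g #{u ∈ S | u ≤ v} = ∑ t ∈ range (#S - 1), g (t + 1) := by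
  rw [← card_erase_of_mem hn, ← sum_rank]
  refine sum_congr rfl fun v hv => ?_
  have hvn := lt_of_le_of_ne (hS v (mem_of_mem_erase hv)) (ne_of_mem_erase hv)
  congr 2
  ext u
  simp only [mem_filter, mem_erase]
  constructor
  · rintro ⟨h1, h2⟩
    exact ⟨⟨by omega, h1⟩, h2⟩
  · rintro ⟨⟨_, h1⟩, h2⟩
    exact ⟨h1, h2⟩

theorem exists_le_push {n v : ℕ} {f : ℕ → ℕ} (hv : v ≤ n)
    (hm : ∀ u, (∃ i, i < n ∧ u ≤ f i) ↔ u < n) (u : ℕ) :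
    (∃ i, i < n + 1 ∧ u ≤ push n f v i) ↔ u < n + 1 := by
  constructor
  · rintro ⟨i, hi, h⟩
    rcases Nat.lt_succ_iff_lt_or_eq.1 hi with h3 | rfl
    · rw [push_of_lt f v h3, le_shift_iff] at h
      have := (hm _).1 ⟨i, h3, h⟩
      unfold pull at this; split_ifs at this <;> omega
    · rw [push_self] at h
      omega
  · intro hu
    by_cases huv : u ≤ v
    · exact ⟨n, by omega, by rwa [push_self]⟩
    · obtain ⟨i, hi, h⟩ := (hm (u - 1)).2 (by omega)
      refine ⟨i, by omega, ?_⟩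
      rw [push_of_lt f v hi, le_shift_iff, pull, if_neg huv]
      exact h

open Classical in
/-- The values that may be appended without creating an occurrence. -/
noncomputable def sites (Q : ℕ → ℕ → ℕ → Prop) (g n : ℕ) (f : ℕ → ℕ) : Finset ℕ :=
  {v ∈ range (n + 1) | ¬ Occ Q g n f v}

theorem mem_sites {Q : ℕ → ℕ → ℕ → Prop} {g n : ℕ} {f : ℕ → ℕ} {v : ℕ} :
    v ∈ sites Q g n f ↔ v ≤ n ∧ ¬ Occ Q g n f v := by
  simp [sites]

theorem desc_succ_eq_sum_sites (Q : ℕ → ℕ → ℕ → Prop) (g d n : ℕ) (f : ℕ → ℕ) :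
    desc (fun n f v => ¬ Occ Q g n f v) (d + 1) n f =
      ∑ v ∈ sites Q g n f, desc (fun n f v => ¬ Occ Q g n f v) d (n + 1) (push n f v) := by
  rw [desc]
  refine sum_congr ?_ fun _ _ => rfl
  ext v
  simp [mem_sites]

theorem not_occ312 {g n b : ℕ} {f : ℕ → ℕ} (hb : ∀ u, (∃ i, i + g ≤ n ∧ u ≤ f i) ↔ u + b < n)
    {u : ℕ} (hu : n ≤ u + b) : ¬ Occ Q312 g n f u := by
  rintro ⟨i, j, h1, h2, h3, h4⟩
  have := (hb u).1 ⟨i, by omega, h4⟩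
  omega

/-- The largest value at a usable place is `n - 1 - b`, if there is one. Appending `v` keeps the
alive values up to `v` and kills those above `v` up to `n - b`; the ones beyond are alive since no
usable letter exceeds them. -/
theorem sites312_push {g n b v : ℕ} {f : ℕ → ℕ} (hg : 1 ≤ g) (hb' : b ≤ n)
    (hb : ∀ u, (∃ i, i + g ≤ n ∧ u ≤ f i) ↔ u + b < n) (hv : v ∈ sites Q312 g n f) :
    sites Q312 g (n + 1) (push n f v) =
      {u ∈ sites Q312 g n f | u ≤ v} ∪ Icc (max (v + 1) (n + 1 - b)) (n + 1) := by
  obtain ⟨hvn, hv⟩ := mem_sites.1 hv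
  ext u
  simp only [mem_union, mem_filter, mem_sites, mem_Icc, occ312_push hg]
  have hb1 : v < u → ((∃ i, i + g ≤ n ∧ u ≤ f i + 1) ↔ u + b ≤ n) := by
    intro hvu
    have := hb (u - 1)
    simp only [Nat.sub_le_iff_le_add] at this
    rw [this]
    omega
  by_cases huv : u ≤ v
  · rw [pull, if_pos huv]
    constructor
    · rintro ⟨h1, h2⟩
      exact Or.inl ⟨⟨by omega, fun h => h2 (Or.inl h)⟩, huv⟩
    · rintro (⟨⟨h1, h2⟩, h3⟩ | h)
      · refine ⟨by omega, ?_⟩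
        rintro (h | ⟨h, -⟩)
        · exact h2 h
        · omega
      · omega
  · rw [pull, if_neg huv, hb1 (by omega)]
    constructor
    · rintro ⟨h1, h2⟩
      right
      omega
    · rintro (h | h)
      · omega
      · refine ⟨h.2, ?_⟩
        rintro (h2 | h2)
        · exact not_occ312 hb (by omega) h2
        · omega

theorem card_sites312_push {g n b v : ℕ} {f : ℕ → ℕ} (hg : 1 ≤ g) (hb' : b ≤ n)
    (hb : ∀ u, (∃ i, i + g ≤ n ∧ u ≤ f i) ↔ u + b < n) (hv : v ∈ sites Q312 g n f) :
    #(sites Q312 g (n + 1) (push n f v)) =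
      #{u ∈ sites Q312 g n f | u ≤ v} + (n + 2 - max (v + 1) (n + 1 - b)) := by
  rw [sites312_push hg hb' hb hv, card_union_of_disjoint, Nat.card_Icc]
  rw [disjoint_left]
  intro u hu
  simp only [mem_filter, mem_Icc] at hu ⊢
  omega

/-- An alive value of rank `r` leads to `r + 1` alive values, the extra one being the new maximum.
-/
theorem desc_312 (d n k : ℕ) (f : ℕ → ℕ) (hk : #(sites Q312 1 n f) = k)
    (hm : ∀ u, (∃ i, i < n ∧ u ≤ f i) ↔ u < n) :
    desc (fun n f v => ¬ Occ Q312 1 n f v) d n f = catTree d k := by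
  induction d generalizing n k f with
  | zero => rfl
  | succ d ih =>
    have hS : ∀ v ∈ sites Q312 1 n f, v ≤ n := fun v hv => (mem_sites.1 hv).1
    have hnS : n ∈ sites Q312 1 n f := mem_sites.2 ⟨le_rfl, not_occ312 (b := 0) hm (by omega)⟩
    have hc : ∀ v ∈ sites Q312 1 n f, desc (fun n f v => ¬ Occ Q312 1 n f v) d (n + 1)
        (push n f v) = catTree d (#{u ∈ sites Q312 1 n f | u ≤ v} + 1) := by
      intro v hv
      refine ih _ _ _ ?_ (exists_le_push (hS v hv) hm)
      rw [card_sites312_push (b := 0) le_rfl (by omega) hm hv]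
      have := hS v hv
      omega
    rw [desc_succ_eq_sum_sites, sum_congr rfl hc, ← add_sum_erase _ _ hnS,
      sum_erase_rank hS hnS (fun r => catTree d (r + 1)), filter_true_of_mem hS, hk, catTree]

/-- The state is `true` when the maximum is the last letter and so cannot pair with the next one. An
append below the maximal value `n` then leaves one more value alive, hence rank plus `1 + b.toNat`.
-/
theorem desc_312_gap (d n k : ℕ) (f : ℕ → ℕ) (b : Bool) (h1 : 1 ≤ n)
    (hk : #(sites Q312 2 n f) = k) (hk2 : 2 ≤ k) (hm : ∀ u, (∃ i, i < n ∧ u ≤ f i) ↔ u < n)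
    (hb : ∀ u, (∃ i, i + 2 ≤ n ∧ u ≤ f i) ↔ u + b.toNat < n) :
    desc (fun n f v => ¬ Occ Q312 2 n f v) d n f = gapTree d b k := by
  induction d generalizing n k f b with
  | zero => cases b <;> rfl
  | succ d ih =>
    have hS : ∀ v ∈ sites Q312 2 n f, v ≤ n := fun v hv => (mem_sites.1 hv).1
    have hb1 := b.toNat_le
    have hnS : n ∈ sites Q312 2 n f := mem_sites.2 ⟨le_rfl, not_occ312 hb (by omega)⟩
    have hr : ∀ v ∈ sites Q312 2 n f, 1 ≤ #{u ∈ sites Q312 2 n f | u ≤ v} :=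
      fun v hv => card_pos.2 ⟨v, mem_filter.2 ⟨hv, le_rfl⟩⟩
    have hc : ∀ v ∈ (sites Q312 2 n f).erase n, desc (fun n f v => ¬ Occ Q312 2 n f v) d (n + 1)
        (push n f v) = gapTree d false (#{u ∈ sites Q312 2 n f | u ≤ v} + (1 + b.toNat)) := by
      intro v hv
      have hvS := mem_of_mem_erase hv
      have hvn := lt_of_le_of_ne (hS v hvS) (ne_of_mem_erase hv)
      have := hr v hvS
      refine ih _ _ _ _ (by omega) ?_ (by omega) (exists_le_push hvn.le hm) fun u => ?_
      · rw [card_sites312_push (by omega) (by omega) hb hvS]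
        omega
      · have hu : (∃ i, i + 2 ≤ n + 1 ∧ u ≤ push n f v i) ↔ ∃ i, i < n ∧ pull v u ≤ f i := by
          refine exists_congr fun i => ?_
          rw [show i + 2 ≤ n + 1 ↔ i < n by omega]
          refine and_congr_right fun hi => ?_
          rw [push_of_lt f v hi, le_shift_iff]
        rw [hu, hm]
        simp only [Bool.toNat_false]
        unfold pull; split_ifs <;> omega
    have hcn : desc (fun n f v => ¬ Occ Q312 2 n f v) d (n + 1) (push n f n) =
        gapTree d true (k + 1) := by
      refine ih _ _ _ _ (by omega) ?_ (by omega) (exists_le_push le_rfl hm) fun u => ?_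
      · rw [card_sites312_push (by omega) (by omega) hb hnS, filter_true_of_mem hS, hk]
        omega
      · have hu : (∃ i, i + 2 ≤ n + 1 ∧ u ≤ push n f n i) ↔ ∃ i, i < n ∧ u ≤ f i := by
          refine exists_congr fun i => ?_
          rw [show i + 2 ≤ n + 1 ↔ i < n by omega]
          refine and_congr_right fun hi => ?_
          have := (hm (f i)).1 ⟨i, hi, le_rfl⟩
          rw [push_of_lt f n hi, shift, if_pos this]
        rw [hu, hm]
        simp
    rw [desc_succ_eq_sum_sites, ← add_sum_erase _ _ hnS, sum_congr rfl hc,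
      sum_erase_rank hS hnS (fun r => gapTree d false (r + (1 + b.toNat))), hk, hcn]
    cases b with
    | false => rw [gapTree]; rfl
    | true =>
      obtain ⟨k, rfl⟩ : ∃ l, k = l + 2 := ⟨k - 2, by omega⟩
      rw [gapTree, show k + 2 - 1 = k + 1 by omega, sum_range_succ,
        add_comm (∑ _ ∈ _, _), ← add_assoc]
      rfl

open PowerSeries

/-! ### Generating functions of the trees -/

/-- This is the rule of `catTree` for powers of the Catalan series; each step multiplies out one
factor `C = 1 + X * C ^ 2`. -/
theorem catalanSeries_pow_succ (k : ℕ) :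
    catalanSeries ^ (k + 1) = 1 + X * (catalanSeries ^ (k + 2) +
      ∑ t ∈ range k, catalanSeries ^ (t + 2)) := by
  have hC := catalanSeries_sq_mul_X_add_one
  induction k with
  | zero => simp [mul_comm, add_comm (1 : PowerSeries ℕ), hC]
  | succ k ih =>
    rw [sum_range_succ]
    calc catalanSeries ^ (k + 1 + 1) = catalanSeries ^ (k + 1) * catalanSeries := pow_succ _ _
      _ = catalanSeries ^ (k + 1) * (catalanSeries ^ 2 * X + 1) := by rw [hC]
      _ = X * catalanSeries ^ (k + 3) + catalanSeries ^ (k + 1) := by ring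
      _ = _ := by rw [ih]; ring

theorem coeff_succ_one_add_X_mul {R : Type*} [Semiring R] (S : PowerSeries R) (d : ℕ) :
    coeff (d + 1) (1 + X * S) = coeff d S := by
  simp [coeff_succ_X_mul, coeff_one]

theorem catTree_eq_coeff (d k : ℕ) : catTree d (k + 1) = coeff d (catalanSeries ^ (k + 1)) := by
  induction d generalizing k with
  | zero => simp [catTree]
  | succ d ih =>
    rw [catalanSeries_pow_succ, catTree, ih, coeff_succ_one_add_X_mul, map_add, map_sum]
    exact congrArg₂ _ rfl (sum_congr rfl fun t _ => ih (t + 1))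

theorem catTree_one (n : ℕ) : catTree n 1 = catalan n := by
  simpa using catTree_eq_coeff n 0

/-- The quotient by `X` of a series that reverts `X * (1 - X - X ^ 2) / (1 - X ^ 2)`. -/
def IsGapSeries (A : PowerSeries ℤ) : Prop := A = 1 + X * A ^ 2 + X ^ 2 * A ^ 2 * (A - 1)

theorem IsRevertSeries.exists_gapSeries {B : PowerSeries ℤ} (hB : IsRevertSeries B) :
    ∃ A, IsGapSeries A ∧ B = X * A := by
  obtain ⟨A, rfl⟩ := X_dvd_iff.2 hB.1
  refine ⟨A, mul_left_cancel₀ (X_ne_zero (R := ℤ)) ?_, rfl⟩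
  linear_combination hB.2

/-- The rule of `gapTree` in state `false`, where label `k` has series `A ^ k` and in state `true`
it has `A ^ k + X * A ^ (k + 1) - X * A ^ 2`. -/
theorem IsGapSeries.pow {A : PowerSeries ℤ} (hA : IsGapSeries A) (k : ℕ) :
    A ^ (k + 2) = 1 + X * ((A ^ (k + 3) + X * A ^ (k + 4) - X * A ^ 2) +
      ∑ t ∈ range (k + 1), A ^ (t + 2)) := by
  unfold IsGapSeries at hA
  induction k with
  | zero =>
    simp only [zero_add, sum_range_one]
    linear_combination (A + 1) * hA
  | succ k ih =>
    rw [sum_range_succ]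
    linear_combination ih + A ^ (k + 2) * hA

theorem gapTree_eq_coeff {A : PowerSeries ℤ} (hA : IsGapSeries A) (d k : ℕ) :
    (gapTree d false (k + 2) : ℤ) = coeff d (A ^ (k + 2)) ∧
    (gapTree d true (k + 2) : ℤ) =
      coeff d (A ^ (k + 2) + X * A ^ (k + 3) - X * A ^ 2) := by
  induction d generalizing k with
  | zero =>
    have h0 : constantCoeff A = 1 := by
      have := congrArg constantCoeff hA
      simpa using this
    simp [gapTree, h0]
  | succ d ih =>
    have hY : A ^ (k + 2) + X * A ^ (k + 3) - X * A ^ 2 =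
        1 + X * ((A ^ (k + 3) + X * A ^ (k + 4) - X * A ^ 2) + A ^ (k + 3) +
          ∑ t ∈ range k, A ^ (t + 3)) := by
      have h := hA.pow k
      rw [sum_range_succ'] at h
      linear_combination h
    rw [hY, hA.pow k, gapTree, gapTree]
    push_cast
    rw [coeff_succ_one_add_X_mul, coeff_succ_one_add_X_mul]
    constructor
    · rw [map_add, map_sum, (ih (k + 1)).2]
      exact congrArg₂ _ rfl (sum_congr rfl fun t _ => (ih t).1)
    · rw [map_add, map_add, map_sum, (ih (k + 1)).1, (ih (k + 1)).2]
      exact congrArg₂ _ rfl (sum_congr rfl fun t _ => (ih (t + 1)).1)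

/-- The defining equation of `A` says that `A = 1 + X * Y`, with `Y` the series of label 2 in state
`true`; the factor in `B = X * A` shifts the index once more. -/
theorem gapTree_eq_coeff_revert {B : PowerSeries ℤ} (hB : IsRevertSeries B) (n : ℕ) :
    (gapTree n true 2 : ℤ) = coeff (n + 2) B := by
  obtain ⟨A, hA, rfl⟩ := hB.exists_gapSeries
  have h : A = 1 + X * (A ^ 2 + X * A ^ 3 - X * A ^ 2) := by
    unfold IsGapSeries at hA
    linear_combination hA
  rw [(gapTree_eq_coeff hA n 0).2, coeff_succ_X_mul]
  conv_rhs => rw [h]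
  rw [coeff_succ_one_add_X_mul]

/-- The rule of `midTree` in state `false`. The common factor `1 + X * (A - 1)` is what makes `A = 1
+ X * Y` hold for the series `Y` of its root. -/
theorem IsGapSeries.mul_pow {A : PowerSeries ℤ} (hA : IsGapSeries A) (k : ℕ) :
    (1 + X * (A - 1)) * A ^ (k + 2) = 1 + X * ((1 + X * (A - 1)) * A ^ (k + 3) +
      (1 + X * (A - 1)) * (A ^ (k + 2) + X * A ^ (k + 4)) +
      ∑ t ∈ range k, (1 + X * (A - 1)) * A ^ (t + 2)) := by
  unfold IsGapSeries at hA
  induction k with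
  | zero =>
    simp only [zero_add, range_zero, sum_empty]
    linear_combination (X + (1 + X * (A - 1)) * (A + 1)) * hA
  | succ k ih =>
    rw [sum_range_succ]
    linear_combination ih + (1 + X * (A - 1)) * A ^ (k + 2) * hA

theorem midTree_eq_coeff {A : PowerSeries ℤ} (hA : IsGapSeries A) (d k : ℕ) :
    (midTree d false (k + 2) : ℤ) = coeff d ((1 + X * (A - 1)) * A ^ (k + 2)) ∧
    (midTree d true (k + 3) : ℤ) =
      coeff d ((1 + X * (A - 1)) * (A ^ (k + 2) + X * A ^ (k + 4))) := by
  induction d generalizing k with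
  | zero =>
    have h0 : constantCoeff A = 1 := by
      have := congrArg constantCoeff hA
      simpa using this
    simp [midTree, h0]
  | succ d ih =>
    have hY : (1 + X * (A - 1)) * (A ^ (k + 2) + X * A ^ (k + 4)) =
        1 + X * ((1 + X * (A - 1)) * A ^ (k + 4) + (1 + X * (A - 1)) * A ^ (k + 3) +
          (1 + X * (A - 1)) * (A ^ (k + 2) + X * A ^ (k + 4)) +
          ∑ t ∈ range k, (1 + X * (A - 1)) * A ^ (t + 2)) := by
      linear_combination hA.mul_pow k
    rw [hY, hA.mul_pow k, midTree, midTree]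
    push_cast
    rw [coeff_succ_one_add_X_mul, coeff_succ_one_add_X_mul]
    constructor
    · rw [map_add, map_add, map_sum, (ih (k + 1)).1, (ih k).2]
      exact congrArg₂ _ rfl (sum_congr rfl fun t _ => (ih t).1)
    · rw [map_add, map_add, map_add, map_sum, (ih (k + 1)).1, (ih (k + 2)).1, (ih k).2]
      exact congrArg₂ _ rfl (sum_congr rfl fun t _ => (ih t).1)

theorem midTree_eq_coeff_revert {B : PowerSeries ℤ} (hB : IsRevertSeries B) (n : ℕ) :
    (midTree n false 2 : ℤ) = coeff (n + 2) B := by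
  obtain ⟨A, hA, rfl⟩ := hB.exists_gapSeries
  have h : A = 1 + X * ((1 + X * (A - 1)) * A ^ 2) := by
    unfold IsGapSeries at hA
    linear_combination hA
  rw [(midTree_eq_coeff hA n 0).1, coeff_succ_X_mul]
  conv_rhs => rw [h]
  rw [coeff_succ_one_add_X_mul]

/-! ### Existence and uniqueness of the reverted series -/

/-- On series without constant term the map is an `X`-adic contraction: the difference of its values
has the factor `B - B'` times a multiple of `X`. -/
theorem revert_step_dvd {B B' : PowerSeries ℤ} (hB : X ∣ B) (hB' : X ∣ B') {n : ℕ}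
    (h : X ^ n ∣ B - B') :
    X ^ (n + 1) ∣ (X * (1 - B ^ 2) + B ^ 2 + B ^ 3) - (X * (1 - B' ^ 2) + B' ^ 2 + B' ^ 3) := by
  obtain ⟨C, rfl⟩ := hB
  obtain ⟨C', rfl⟩ := hB'
  obtain ⟨D, hD⟩ := h
  refine ⟨D * ((C + C') * (1 - X) + X * (C ^ 2 + C * C' + C' ^ 2)), ?_⟩
  linear_combination ((X * C + X * C') * (1 - X) + (X * C) ^ 2 + X * C * (X * C') +
    (X * C') ^ 2) * hD

theorem isRevertSeries_iff {B : PowerSeries ℤ} :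
    IsRevertSeries B ↔ X ∣ B ∧ B = X * (1 - B ^ 2) + B ^ 2 + B ^ 3 := by
  rw [IsRevertSeries, ← X_dvd_iff]
  refine and_congr_right fun _ => ⟨fun h => ?_, fun h => ?_⟩ <;> linear_combination h

theorem eq_zero_of_forall_X_pow_dvd {B : PowerSeries ℤ} (h : ∀ n, X ^ n ∣ B) : B = 0 := by
  ext n
  exact X_pow_dvd_iff.1 (h (n + 1)) n (by omega)

/-- A Banach fixed point argument: the iterates of `Φ` from 0 converge `X`-adically, and any
solution is congruent to them. -/
theorem existsUnique_revertSeries : ∃! B : PowerSeries ℤ, IsRevertSeries B := by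
  let Φ : PowerSeries ℤ → PowerSeries ℤ := fun B => X * (1 - B ^ 2) + B ^ 2 + B ^ 3
  have hX : ∀ B, X ∣ B → X ∣ Φ B := fun B hB =>
    ((Dvd.intro _ rfl).add (hB.trans (dvd_pow_self _ two_ne_zero))).add
      (hB.trans (dvd_pow_self _ three_ne_zero))
  let S : ℕ → PowerSeries ℤ := fun m => Φ^[m] 0
  have hS : ∀ m, S (m + 1) = Φ (S m) := fun m => Function.iterate_succ_apply' Φ m 0
  have hSX : ∀ m, X ∣ S m := by
    intro m
    induction m with
    | zero => exact dvd_zero X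
    | succ m ih => rw [hS]; exact hX _ ih
  have hstep : ∀ m, X ^ m ∣ S (m + 1) - S m := by
    intro m
    induction m with
    | zero => simp
    | succ m ih =>
      rw [hS (m + 1), hS m]
      have := revert_step_dvd (hSX (m + 1)) (hSX m) ih
      rw [hS m] at this
      exact this
  have hdiff : ∀ m k, X ^ m ∣ S (m + k) - S m := by
    intro m k
    induction k with
    | zero => simp
    | succ k ih =>
      have := ((pow_dvd_pow X (by omega : m ≤ m + k)).trans (hstep (m + k))).add ih
      rwa [sub_add_sub_cancel] at this
  -- The coefficient of index `n` no longer changes from the iterate `n + 1` on.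
  let B : PowerSeries ℤ := PowerSeries.mk fun n => coeff n (S (n + 1))
  have hB : ∀ m, X ^ m ∣ B - S m := by
    intro m
    rw [X_pow_dvd_iff]
    intro n hn
    have h := X_pow_dvd_iff.1 (hdiff (n + 1) (m - (n + 1))) n (by omega)
    rw [show n + 1 + (m - (n + 1)) = m by omega, map_sub, sub_eq_zero] at h
    rw [map_sub, h, coeff_mk, sub_self]
  have hBX : X ∣ B := by
    have := (hB 1)
    rw [pow_one] at this
    simpa using this.add (hSX 1)
  refine ⟨B, isRevertSeries_iff.2 ⟨hBX, ?_⟩, fun B' hB' => ?_⟩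
  · rw [← sub_eq_zero]
    refine eq_zero_of_forall_X_pow_dvd fun n => ?_
    have h1 := hB (n + 1)
    have h2 := revert_step_dvd hBX (hSX n) (hB n)
    rw [hS] at h1
    have h3 := (pow_dvd_pow X (by omega : n ≤ n + 1)).trans (h1.sub h2)
    rwa [show B - Φ (S n) - (X * (1 - B ^ 2) + B ^ 2 + B ^ 3 - Φ (S n)) =
      B - (X * (1 - B ^ 2) + B ^ 2 + B ^ 3) by ring] at h3
  · obtain ⟨hX', hB'⟩ := isRevertSeries_iff.1 hB'
    rw [← sub_eq_zero]
    refine eq_zero_of_forall_X_pow_dvd fun n => ?_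
    have hS' : ∀ m, X ^ m ∣ B' - S m := by
      intro m
      induction m with
      | zero => simp
      | succ m ih =>
        rw [hS, hB']
        exact revert_step_dvd hX' (hSX m) ih
    have := (hS' n).sub (hB n)
    rwa [sub_sub_sub_cancel_right] at this

/-! ### Counting by computation -/

/-- The supremum of `w` over the entries of a list. -/
def supSingle (w : ℕ → ℕ) : List ℕ → ℕ
  | [] => 0
  | a :: t => max (w a) (supSingle w t)

/-- The supremum of `w` over the pairs of entries of a list. -/
def supPair (w : ℕ → ℕ → ℕ) : List ℕ → ℕ
  | [] => 0
  | a :: t => max (supSingle (w a) t) (supPair w t)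

/-- The supremum of `w` over the triples of entries of a list. -/
def supTriple (w : ℕ → ℕ → ℕ → ℕ) : List ℕ → ℕ
  | [] => 0
  | a :: t => max (supPair (w a) t) (supTriple w t)

theorem lt_supSingle_map_range (f : ℕ → ℕ) (w : ℕ → ℕ) (n v : ℕ) :
    v < supSingle w ((List.range n).map f) ↔ ∃ i, i < n ∧ v < w (f i) := by
  induction n generalizing f with
  | zero => simp [supSingle]
  | succ n ih =>
    rw [List.range_succ_eq_map, List.map_cons, List.map_map, supSingle, lt_max_iff, ih]
    constructor
    · rintro (h | ⟨i, hi, h⟩)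
      · exact ⟨0, by omega, h⟩
      · exact ⟨i + 1, by omega, h⟩
    · rintro ⟨i, hi, h⟩
      cases i with
      | zero => exact Or.inl h
      | succ i => exact Or.inr ⟨i, by omega, h⟩

theorem lt_supPair_map_range (f : ℕ → ℕ) (w : ℕ → ℕ → ℕ) (n v : ℕ) :
    v < supPair w ((List.range n).map f) ↔ ∃ i j, i < j ∧ j < n ∧ v < w (f i) (f j) := by
  induction n generalizing f with
  | zero => simp [supPair]
  | succ n ih =>
    rw [List.range_succ_eq_map, List.map_cons, List.map_map, supPair, lt_max_iff, ih,
      lt_supSingle_map_range]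
    constructor
    · rintro (⟨i, hi, h⟩ | ⟨i, j, hij, hj, h⟩)
      · exact ⟨0, i + 1, by omega, by omega, h⟩
      · exact ⟨i + 1, j + 1, by omega, by omega, h⟩
    · rintro ⟨i, j, hij, hj, h⟩
      obtain ⟨j, rfl⟩ : ∃ j', j = j' + 1 := ⟨j - 1, by omega⟩
      cases i with
      | zero => exact Or.inl ⟨j, by omega, h⟩
      | succ i => exact Or.inr ⟨i, j, by omega, by omega, h⟩

theorem lt_supTriple_map_range (f : ℕ → ℕ) (w : ℕ → ℕ → ℕ → ℕ) (n v : ℕ) :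
    v < supTriple w ((List.range n).map f) ↔
      ∃ i j k, i < j ∧ j < k ∧ k < n ∧ v < w (f i) (f j) (f k) := by
  induction n generalizing f with
  | zero => simp [supTriple]
  | succ n ih =>
    rw [List.range_succ_eq_map, List.map_cons, List.map_map, supTriple, lt_max_iff, ih,
      lt_supPair_map_range]
    constructor
    · rintro (⟨i, j, hij, hj, h⟩ | ⟨i, j, k, hij, hjk, hk, h⟩)
      · exact ⟨0, i + 1, j + 1, by omega, by omega, by omega, h⟩
      · exact ⟨i + 1, j + 1, k + 1, by omega, by omega, by omega, h⟩
    · rintro ⟨i, j, k, hij, hjk, hk, h⟩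
      obtain ⟨j, rfl⟩ : ∃ j', j = j' + 1 := ⟨j - 1, by omega⟩
      obtain ⟨k, rfl⟩ : ∃ k', k = k' + 1 := ⟨k - 1, by omega⟩
      cases i with
      | zero => exact Or.inl ⟨j, k, by omega, by omega, h⟩
      | succ i => exact Or.inr ⟨i, j, k, by omega, by omega, by omega, h⟩

/-- `force x k` is `k x`, evaluated in the kernel after `x`. -/
def force {α : Type} (x : ℕ) (k : ℕ → α) : α := Nat.rec (k 0) (fun n _ => k (n + 1)) x

theorem force_eq {α : Type} (x : ℕ) (k : ℕ → α) : force x k = k x := by cases x <;> rfl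

/-- `forceShift v l k` is `k (l.map (shift v) ++ [v])`, evaluated in the kernel after the list. -/
def forceShift {α : Type} (v : ℕ) : List ℕ → (List ℕ → α) → α
  | [], k => k [v]
  | a :: t, k => force (shift v a) fun b => forceShift v t fun s => k (b :: s)

theorem forceShift_eq {α : Type} (v : ℕ) (l : List ℕ) (k : List ℕ → α) :
    forceShift v l k = k (l.map (shift v) ++ [v]) := by
  induction l generalizing k with
  | nil => rfl
  | cons a t ih => simp [forceShift, force_eq, ih]

/-- The number of ways to append `d` values to the list `l`, where the value `v` may be appended
if it is at least `supTriple w l`. -/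
def listDesc (w : ℕ → ℕ → ℕ → ℕ) : ℕ → List ℕ → ℕ
  | 0, _ => 1
  -- The alive values of the last level are only counted, so the leaves of the tree are never built.
  | 1, l => l.length + 1 - supTriple w l
  | d + 2, l => force (supTriple w l) fun m => ((List.range (l.length + 1 - m)).map fun t =>
      force (m + t) fun v => forceShift v l (listDesc w (d + 1))).sum

theorem map_shift_append (n v : ℕ) (f : ℕ → ℕ) :
    ((List.range n).map f).map (shift v) ++ [v] = (List.range (n + 1)).map (push n f v) := by
  rw [List.range_succ, List.map_append, List.map_map]
  congr 1
  · refine List.map_congr_left fun i hi => ?_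
    rw [push_of_lt f _ (List.mem_range.1 hi)]
    rfl
  · simp

theorem listDesc_map_range {P : ℕ → (ℕ → ℕ) → ℕ → Prop} {w : ℕ → ℕ → ℕ → ℕ}
    (hP : ∀ n f v, P n f v ↔ ¬ ∃ i j k, i < j ∧ j < k ∧ k < n ∧ v < w (f i) (f j) (f k))
    (d n : ℕ) (f : ℕ → ℕ) : listDesc w d ((List.range n).map f) = desc P d n f := by
  have ha : ∀ n f, ∀ v ≤ n, P n f v ↔ supTriple w ((List.range n).map f) ≤ v := by
    intro n f v _
    rw [hP, ← lt_supTriple_map_range, not_lt]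
  induction d generalizing n f with
  | zero => rfl
  | succ d ih =>
    rw [desc_succ_of_le rfl (ha n f)]
    cases d with
    | zero => simp [listDesc, desc]
    | succ d =>
      simp only [listDesc, force_eq, forceShift_eq, map_shift_append, ih]
      rw [List.length_map, List.length_range]
      rfl

/-- For patterns whose last value must be small, each triple of earlier values kills an initial
segment of values, of length `w a b c`. -/
theorem avoidCount_eq_listDesc {p : POP 4} {w : ℕ → ℕ → ℕ → ℕ}
    (hw : ∀ v a b c, p.rel (shift v a) (shift v b) (shift v c) v ↔ v < w a b c) (n : ℕ) :
    p.avoidCount n = listDesc w n [] := by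
  rw [avoidCount_eq_desc, ← listDesc_map_range (w := w) fun n f v => by simp only [Alive4, hw]]
  rfl

/-! ### A descent followed by a pair -/

/-- The number of nodes at depth `d` below a node with label `h` of the tree in which a node with
label `h` has children with labels `1, …, h`. -/
def tailTree : ℕ → ℕ → ℕ
  | 0, _ => 1
  | d + 1, h => ∑ t ∈ range h, tailTree d (t + 1)

/-- The number of nodes at depth `d` below a node `n` of the tree in which `n` has the child `n + 1`
and `n` children that are nodes with label `n + 2` of the tree of `tailTree`. -/
def headTree : ℕ → ℕ → ℕ
  | 0, _ => 1
  | d + 1, n => headTree d (n + 1) + n * tailTree d (n + 2)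

/-- The word has an inversion. -/
def Inv (n : ℕ) (f : ℕ → ℕ) : Prop := ∃ i j, i < j ∧ j < n ∧ f j < f i

/-- No inversion is followed by a value `x` with `Q x v`. -/
def NoTail (Q : ℕ → ℕ → Prop) (n : ℕ) (f : ℕ → ℕ) (v : ℕ) : Prop :=
  ¬ ∃ i j k, i < j ∧ j < k ∧ k < n ∧ f j < f i ∧ Q (f k) v

theorem inv_push (n : ℕ) (f : ℕ → ℕ) (v : ℕ) :
    Inv (n + 1) (push n f v) ↔ Inv n f ∨ ∃ i, i < n ∧ v ≤ f i := by
  constructor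
  · rintro ⟨i, j, hij, hj, h⟩
    rw [push_of_lt f v (by omega : i < n)] at h
    rcases Nat.lt_succ_iff_lt_or_eq.1 hj with h3 | rfl
    · rw [push_of_lt f v h3, shift_lt_shift] at h
      exact Or.inl ⟨i, j, hij, h3, h⟩
    · rw [push_self, self_lt_shift] at h
      exact Or.inr ⟨i, hij, h⟩
  · rintro (⟨i, j, hij, hj, h⟩ | ⟨i, hi, h⟩)
    · exact ⟨i, j, hij, by omega, by
        rwa [push_of_lt f v (by omega : i < n), push_of_lt f v hj, shift_lt_shift]⟩
    · exact ⟨i, n, hi, by omega, by rwa [push_of_lt f v hi, push_self, self_lt_shift]⟩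

theorem noTail_push {Q : ℕ → ℕ → Prop} (hQ : ∀ v x u, Q (shift v x) u ↔ Q x (pull v u))
    (n : ℕ) (f : ℕ → ℕ) (v u : ℕ) :
    NoTail Q (n + 1) (push n f v) u ↔ NoTail Q n f (pull v u) ∧ ¬ (Inv n f ∧ Q v u) := by
  unfold NoTail
  rw [← not_or, not_iff_not]
  constructor
  · rintro ⟨i, j, k, hij, hjk, hk, h, hq⟩
    rw [push_of_lt f v (by omega : i < n), push_of_lt f v (by omega : j < n),
      shift_lt_shift] at h
    rcases Nat.lt_succ_iff_lt_or_eq.1 hk with h3 | rfl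
    · rw [push_of_lt f v h3, hQ] at hq
      exact Or.inl ⟨i, j, k, hij, hjk, h3, h, hq⟩
    · rw [push_self] at hq
      exact Or.inr ⟨⟨i, j, hij, hjk, h⟩, hq⟩
  · rintro (⟨i, j, k, hij, hjk, hk, h, hq⟩ | ⟨⟨i, j, hij, hj, h⟩, hq⟩)
    · exact ⟨i, j, k, hij, hjk, by omega, by
        rwa [push_of_lt f v (by omega : i < n), push_of_lt f v (by omega : j < n),
          shift_lt_shift], by rwa [push_of_lt f v hk, hQ]⟩
    · exact ⟨i, j, n, hij, hj, by omega, by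
        rwa [push_of_lt f v (by omega : i < n), push_of_lt f v hj, shift_lt_shift], by
        rwa [push_self]⟩

/-- With an inversion present, each later letter `v` kills the values above it, which leaves `v + 1`
of them. -/
theorem desc_noTail_lt (d n c : ℕ) (f : ℕ → ℕ) (hf : Inv n f) (hn : c ≤ n + 1)
    (ha : ∀ v ≤ n, NoTail (· < ·) n f v ↔ v < c) :
    desc (NoTail (· < ·)) d n f = tailTree d c := by
  induction d generalizing n c f with
  | zero => rfl
  | succ d ih =>
    rw [desc_succ_of_lt hn ha, tailTree]
    refine sum_congr rfl fun v hv => ?_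
    have hv := mem_range.1 hv
    refine ih _ _ _ ((inv_push _ _ _).2 (Or.inl hf)) (by omega) fun u hu => ?_
    rw [noTail_push fun v x u => shift_lt_iff, ha _ (by unfold pull; split_ifs <;> omega)]
    simp only [hf, true_and]
    unfold pull; split_ifs <;> omega

/-- The mirror image: a later letter kills the values up to itself. -/
theorem desc_noTail_ge (d n m k : ℕ) (f : ℕ → ℕ) (hf : Inv n f) (hn : m + k = n + 1)
    (ha : ∀ v ≤ n, NoTail (· ≥ ·) n f v ↔ m ≤ v) :
    desc (NoTail (· ≥ ·)) d n f = tailTree d k := by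
  induction d generalizing n m k f with
  | zero => rfl
  | succ d ih =>
    rw [desc_succ_of_le (k := k) (by omega) ha, tailTree, ← sum_range_reflect]
    refine sum_congr rfl fun t ht => ?_
    have ht := mem_range.1 ht
    refine ih _ (m + (k - 1 - t) + 1) _ _ ((inv_push _ _ _).2 (Or.inl hf)) (by omega)
      fun u hu => ?_
    rw [noTail_push fun v x u => le_shift_iff, ha _ (by unfold pull; split_ifs <;> omega)]
    simp only [hf, true_and]
    unfold pull; split_ifs <;> omega

/-- An increasing word stays increasing only under the append of `n`. The `n` other values create
the first inversion; no letter follows it yet, so all `n + 2` values are alive. -/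
theorem desc_noTail {Q : ℕ → ℕ → Prop} (hQ : ∀ v x u, Q (shift v x) u ↔ Q x (pull v u))
    (hd : ∀ d n f, Inv n f → (∀ v ≤ n, NoTail Q n f v) →
      desc (NoTail Q) d n f = tailTree d (n + 1)) (d n : ℕ) (f : ℕ → ℕ) (hf : ¬ Inv n f)
    (hm : ∀ u, (∃ i, i < n ∧ u ≤ f i) ↔ u < n) :
    desc (NoTail Q) d n f = headTree d n := by
  have ha : ∀ n f, ¬ Inv n f → ∀ v, NoTail Q n f v := by
    rintro n f hf v ⟨i, j, k, hij, hjk, hk, h, -⟩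
    exact hf ⟨i, j, hij, by omega, h⟩
  induction d generalizing n f with
  | zero => rfl
  | succ d ih =>
    rw [desc_succ_of_lt le_rfl fun v hv => iff_of_true (ha n f hf v) (by omega), sum_range_succ,
      add_comm, headTree]
    congr 1
    · refine ih _ _ ?_ (exists_le_push le_rfl hm)
      rw [inv_push, hm]
      simpa using hf
    · rw [sum_congr rfl fun v hv => hd d (n + 1) (push n f v)
        ((inv_push _ _ _).2 (Or.inr ((hm v).2 (mem_range.1 hv)))) fun u _ =>
        (noTail_push hQ _ _ _ _).2 ⟨ha _ _ hf _, fun h => hf h.1⟩]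
      simp

theorem desc_noTail_lt_zero (d : ℕ) : desc (NoTail (· < ·)) d 0 (fun _ => 0) = headTree d 0 := by
  refine desc_noTail (fun v x u => shift_lt_iff) (fun d n f hf ha => ?_) d 0 _ ?_ ?_
  · exact desc_noTail_lt d n _ f hf le_rfl fun v hv => iff_of_true (ha v hv) (by omega)
  · rintro ⟨i, j, -, h, -⟩
    omega
  · simp

theorem desc_noTail_ge_zero (d : ℕ) : desc (NoTail (· ≥ ·)) d 0 (fun _ => 0) = headTree d 0 := by
  refine desc_noTail (fun v x u => le_shift_iff) (fun d n f hf ha => ?_) d 0 _ ?_ ?_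
  · exact desc_noTail_ge d n 0 _ f hf (by omega) fun v hv => iff_of_true (ha v hv) (by omega)
  · rintro ⟨i, j, -, h, -⟩
    omega
  · simp

/-! ### Counts for a chain and a point -/

theorem alive3_eq {R Q : ℕ → ℕ → ℕ → Prop} (h : ∀ v a b, R (shift v a) (shift v b) v ↔ Q a b v) :
    Alive3 R = fun n f v => ¬ Occ Q 1 n f v := by
  funext n f v
  simp only [Alive3, Occ, h, Nat.succ_le_iff]

/-- The isolated second label only demands some place between the first and the third, that is, a
distance of at least 2. -/
theorem alive4_eq {p : POP 4} {Q : ℕ → ℕ → ℕ → Prop}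
    (h : ∀ v a x b, p.rel (shift v a) x (shift v b) v ↔ Q a b v) :
    Alive4 p.rel = fun n f v => ¬ Occ Q 2 n f v := by
  funext n f v
  simp only [Alive4, Occ, h, eq_iff_iff, not_iff_not]
  constructor
  · rintro ⟨i, j, k, hij, hjk, hk, h⟩
    exact ⟨i, k, by omega, hk, h⟩
  · rintro ⟨i, k, hik, hk, h⟩
    exact ⟨i, i + 1, k, by omega, by omega, hk, h⟩

theorem not_occ_of_le {Q : ℕ → ℕ → ℕ → Prop} {g n : ℕ} (hn : n ≤ g) (f : ℕ → ℕ) (v : ℕ) :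
    ¬ Occ Q g n f v := by
  rintro ⟨i, j, h1, h2, -⟩
  omega

theorem sites_of_le {Q : ℕ → ℕ → ℕ → Prop} {g n : ℕ} (hn : n ≤ g) (f : ℕ → ℕ) :
    #(sites Q g n f) = n + 1 := by
  have : sites Q g n f = range (n + 1) := by
    ext v
    rw [mem_sites, mem_range]
    have := not_occ_of_le (Q := Q) hn f v
    simp [this]
  rw [this, card_range]

theorem chainPoint_lt {a b c d : ℕ} (h : [a, b, c, d].Perm [1, 2, 3, 4]) (x y : Fin 4) :
    (chainPoint a b c d h).order.lt x y ↔ (x.val + 1 = b ∧ y.val + 1 = a) ∨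
      (x.val + 1 = c ∧ y.val + 1 = b) ∨ (x.val + 1 = c ∧ y.val + 1 = a) := Iff.rfl

theorem twoChains_lt {a b c d : ℕ} (h : [a, b, c, d].Perm [1, 2, 3, 4]) (x y : Fin 4) :
    (twoChains a b c d h).order.lt x y ↔
      (x.val + 1 = b ∧ y.val + 1 = a) ∨ (x.val + 1 = d ∧ y.val + 1 = c) := Iff.rfl

theorem chainPoint_dual {a b c d : ℕ} (h : [a, b, c, d].Perm [1, 2, 3, 4])
    (h' : [c, b, a, d].Perm [1, 2, 3, 4]) (n : ℕ) :
    (chainPoint a b c d h).avoidCount n = (chainPoint c b a d h').avoidCount n := by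
  refine avoidCount_eq_of_dual (fun x y => ?_) n
  simp only [chainPoint_lt]
  tauto

theorem chainPoint_rev {a b c d a' b' c' d' : ℕ} (h : [a, b, c, d].Perm [1, 2, 3, 4])
    (h' : [a', b', c', d'].Perm [1, 2, 3, 4]) (ha : a + a' = 5) (hb : b + b' = 5)
    (hc : c + c' = 5) (n : ℕ) :
    (chainPoint a b c d h).avoidCount n = (chainPoint a' b' c' d' h').avoidCount n := by
  refine avoidCount_eq_of_rev (fun x y => ?_) n
  simp only [chainPoint_lt, Fin.val_rev]
  omega

theorem avoidCount_chain_321 (n : ℕ) :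
    (chainPoint 3 2 1 4).avoidCount (n + 1) = Nat.centralBinom n := by
  rw [avoidCount_succ_of_rel_eq _ (fun a b c => a < b ∧ b < c)
    (fun v a b c => by simp only [shift_lt_shift])
    (fun a b c d => by simp [rel, chainPoint_lt, Fin.forall_fin_succ]; omega),
    alive3_eq (Q := Q123) (fun v a b => by rw [shift_lt_shift, shift_lt_self, Q123]),
    desc_123 n 0 1 _ le_rfl le_rfl (fun v hv => iff_of_true (not_occ_of_le (by omega) _ _)
      (by omega)) (fun v hv h => by omega), catTree_one, succ_mul_catalan_eq_centralBinom]

theorem avoidCount_chain_132 (n : ℕ) :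
    (chainPoint 1 3 2 4).avoidCount (n + 1) = Nat.centralBinom n := by
  rw [avoidCount_succ_of_rel_eq _ (fun a b c => b < c ∧ c < a)
    (fun v a b c => by simp only [shift_lt_shift])
    (fun a b c d => by simp [rel, chainPoint_lt, Fin.forall_fin_succ]; omega),
    alive3_eq (Q := Q312) (fun v a b => by rw [self_lt_shift, shift_lt_self, Q312]),
    desc_312 n 0 1 _ (sites_of_le (by omega) _) (by simp), catTree_one,
    succ_mul_catalan_eq_centralBinom]

theorem avoidCount_chain_213 (n : ℕ) :
    (chainPoint 2 1 3 4).avoidCount (n + 1) = Nat.centralBinom n := by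
  rw [avoidCount_succ_of_rel_eq _ (fun a b c => a < b ∧ c < a)
    (fun v a b c => by simp only [shift_lt_shift])
    (fun a b c d => by simp [rel, chainPoint_lt, Fin.forall_fin_succ]; omega),
    alive3_eq (Q := Q231) (fun v a b => by rw [self_lt_shift, shift_lt_shift, Q231]),
    desc_231 n 0 0 1 _ le_rfl rfl (fun v hv => iff_of_true (not_occ_of_le (by omega) _ _)
      (by omega)) (fun v hv => by omega), catTree_one, succ_mul_catalan_eq_centralBinom]

theorem desc_succ_zero (Q : ℕ → ℕ → ℕ → Prop) (d : ℕ) (f : ℕ → ℕ) :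
    desc (fun n f v => ¬ Occ Q 2 n f v) (d + 1) 0 f =
      desc (fun n f v => ¬ Occ Q 2 n f v) d 1 (push 0 f 0) := by
  rw [desc_succ_of_lt (h := 1) le_rfl fun v hv => iff_of_true (not_occ_of_le (by omega) _ _)
    (by omega), sum_range_one]

theorem avoidCount_gap_431 (n : ℕ) :
    (chainPoint 4 3 1 2).avoidCount (n + 1) = gapTree n true 2 := by
  rw [avoidCount_eq_desc, alive4_eq (Q := Q123), desc_succ_zero]
  -- The root is the word of length 1: its 0 is the last letter and both values may follow.
  · refine desc_123_gap n 1 2 _ true le_rfl le_rfl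
      (fun v hv => iff_of_true (not_occ_of_le (by omega) _ _) (by omega))
      (fun v hv h => ⟨0, by omega, by simpa using h⟩) fun v hv => ?_
    simp only [Bool.toNat_true]
    exact iff_of_false (fun ⟨i, hi, _⟩ => by omega) (by omega)
  · intro v a x b
    rw [Q123, ← shift_lt_shift (v := v), ← shift_lt_self (x := b)]
    simp [rel, chainPoint_lt, Fin.forall_fin_succ]
    omega

theorem avoidCount_gap_143 (n : ℕ) :
    (chainPoint 1 4 3 2).avoidCount (n + 1) = gapTree n true 2 := by
  rw [avoidCount_eq_desc, alive4_eq (Q := Q312), desc_succ_zero]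
  · refine desc_312_gap n 1 2 _ true le_rfl (sites_of_le (by omega) _) le_rfl (fun u => ?_)
      fun u => ?_
    · constructor
      · rintro ⟨i, hi, h⟩
        obtain rfl : i = 0 := by omega
        rw [push_self] at h
        omega
      · intro h
        exact ⟨0, by omega, by rw [push_self]; omega⟩
    · simp only [Bool.toNat_true]
      exact iff_of_false (fun ⟨i, hi, _⟩ => by omega) (by omega)
  · intro v a x b
    rw [Q312, ← self_lt_shift (v := v), ← shift_lt_self (x := b)]
    simp [rel, chainPoint_lt, Fin.forall_fin_succ]
    omega

/-- The two rules differ; the counts are compared through the coefficients of `B`, which is why its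
existence is needed. -/
theorem midTree_eq_gapTree (n : ℕ) : midTree n false 2 = gapTree n true 2 := by
  obtain ⟨B, hB, -⟩ := existsUnique_revertSeries
  exact_mod_cast (midTree_eq_coeff_revert hB n).trans (gapTree_eq_coeff_revert hB n).symm

theorem avoidCount_gap_314 (n : ℕ) :
    (chainPoint 3 1 4 2).avoidCount (n + 1) = gapTree n true 2 := by
  rw [avoidCount_eq_desc, alive4_eq (Q := Q231), desc_succ_zero, ← midTree_eq_gapTree]
  · refine desc_231_gap n 0 0 2 _ false le_rfl rfl
      (fun v hv => iff_of_true (not_occ_of_le (by omega) _ _) (by omega))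
      (fun x hx h => ?_) (by simp) (fun i hi => by omega)
    rw [push_self] at h
    omega
  · intro v a x b
    rw [Q231, ← self_lt_shift (v := v), ← shift_lt_shift (v := v)]
    simp [rel, chainPoint_lt, Fin.forall_fin_succ]
    omega

theorem cases_of_perm {a b c d : ℕ} (h : [a, b, c, d].Perm [1, 2, 3, 4]) :
    a ∈ Icc 1 4 ∧ b ∈ Icc 1 4 ∧ c ∈ Icc 1 4 ∧ d ∈ Icc 1 4 ∧
      a ≠ b ∧ a ≠ c ∧ a ≠ d ∧ b ≠ c ∧ b ≠ d ∧ c ≠ d := by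
  have hm : ∀ x ∈ [a, b, c, d], x ∈ Icc 1 4 := fun x hx => by
    have := h.mem_iff.1 hx
    simp only [List.mem_cons, List.not_mem_nil, or_false] at this
    rw [mem_Icc]
    omega
  have hn : [a, b, c, d].Nodup := h.nodup_iff.mpr (by decide)
  simp only [List.nodup_cons, List.mem_cons, List.not_mem_nil, or_false, not_or] at hn
  exact ⟨hm a (by simp), hm b (by simp), hm c (by simp), hm d (by simp), hn.1.1, hn.1.2.1,
    hn.1.2.2, hn.2.1.1, hn.2.1.2, hn.2.2.1⟩

theorem avoidCount_chainPoint_four {a b c : ℕ} (h : [a, b, c, 4].Perm [1, 2, 3, 4]) (n : ℕ) :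
    (chainPoint a b c 4 h).avoidCount (n + 1) = Nat.centralBinom n := by
  have h3 : ∀ a ∈ Icc (1 : ℕ) 4, ∀ b ∈ Icc (1 : ℕ) 4, ∀ c ∈ Icc (1 : ℕ) 4,
      a ≠ b ∧ a ≠ c ∧ a ≠ 4 ∧ b ≠ c ∧ b ≠ 4 ∧ c ≠ 4 →
      (a = 3 ∧ b = 2 ∧ c = 1) ∨ (a = 1 ∧ b = 3 ∧ c = 2) ∨ (a = 2 ∧ b = 1 ∧ c = 3) ∨
      (a = 1 ∧ b = 2 ∧ c = 3) ∨ (a = 2 ∧ b = 3 ∧ c = 1) ∨ (a = 3 ∧ b = 1 ∧ c = 2) := by decide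
  obtain ⟨ha, hb, hc, -, hne⟩ := cases_of_perm h
  replace h3 := h3 a ha b hb c hc hne
  rcases h3 with ⟨rfl, rfl, rfl⟩ | ⟨rfl, rfl, rfl⟩ | ⟨rfl, rfl, rfl⟩ | ⟨rfl, rfl, rfl⟩ |
    ⟨rfl, rfl, rfl⟩ | ⟨rfl, rfl, rfl⟩
  · exact avoidCount_chain_321 n
  · exact avoidCount_chain_132 n
  · exact avoidCount_chain_213 n
  · exact (chainPoint_dual h (by decide) _).trans (avoidCount_chain_321 n)
  · exact (chainPoint_dual h (by decide) _).trans (avoidCount_chain_132 n)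
  · exact (chainPoint_dual h (by decide) _).trans (avoidCount_chain_213 n)

theorem avoidCount_chainPoint_two {a b c : ℕ} (h : [a, b, c, 2].Perm [1, 2, 3, 4]) (n : ℕ) :
    (chainPoint a b c 2 h).avoidCount (n + 1) = gapTree n true 2 := by
  have h3 : ∀ a ∈ Icc (1 : ℕ) 4, ∀ b ∈ Icc (1 : ℕ) 4, ∀ c ∈ Icc (1 : ℕ) 4,
      a ≠ b ∧ a ≠ c ∧ a ≠ 2 ∧ b ≠ c ∧ b ≠ 2 ∧ c ≠ 2 →
      (a = 4 ∧ b = 3 ∧ c = 1) ∨ (a = 1 ∧ b = 4 ∧ c = 3) ∨ (a = 3 ∧ b = 1 ∧ c = 4) ∨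
      (a = 1 ∧ b = 3 ∧ c = 4) ∨ (a = 3 ∧ b = 4 ∧ c = 1) ∨ (a = 4 ∧ b = 1 ∧ c = 3) := by decide
  obtain ⟨ha, hb, hc, -, hne⟩ := cases_of_perm h
  replace h3 := h3 a ha b hb c hc hne
  rcases h3 with ⟨rfl, rfl, rfl⟩ | ⟨rfl, rfl, rfl⟩ | ⟨rfl, rfl, rfl⟩ | ⟨rfl, rfl, rfl⟩ |
    ⟨rfl, rfl, rfl⟩ | ⟨rfl, rfl, rfl⟩
  · exact avoidCount_gap_431 n
  · exact avoidCount_gap_143 n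
  · exact avoidCount_gap_314 n
  · exact (chainPoint_dual h (by decide) _).trans (avoidCount_gap_431 n)
  · exact (chainPoint_dual h (by decide) _).trans (avoidCount_gap_143 n)
  · exact (chainPoint_dual h (by decide) _).trans (avoidCount_gap_314 n)

theorem perm_rev {a b c d : ℕ} (h : [a, b, c, d].Perm [1, 2, 3, 4]) :
    [5 - a, 5 - b, 5 - c, 5 - d].Perm [1, 2, 3, 4] :=
  (h.map (5 - ·)).trans (by decide)

theorem avoidCount_chainPoint_extreme {a b c d : ℕ} (h : [a, b, c, d].Perm [1, 2, 3, 4])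
    (hd : d = 1 ∨ d = 4) (n : ℕ) :
    (chainPoint a b c d h).avoidCount (n + 1) = Nat.centralBinom n := by
  rcases hd with rfl | rfl
  · have hc := cases_of_perm h
    simp only [mem_Icc] at hc
    rw [chainPoint_rev h (perm_rev h) (by omega) (by omega) (by omega)]
    exact avoidCount_chainPoint_four _ n
  · exact avoidCount_chainPoint_four h n

theorem avoidCount_chainPoint_middle {a b c d : ℕ} (h : [a, b, c, d].Perm [1, 2, 3, 4])
    (hd : d = 2 ∨ d = 3) (n : ℕ) :
    (chainPoint a b c d h).avoidCount (n + 1) = gapTree n true 2 := by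
  rcases hd with rfl | rfl
  · exact avoidCount_chainPoint_two h n
  · have hc := cases_of_perm h
    simp only [mem_Icc] at hc
    rw [chainPoint_rev h (perm_rev h) (by omega) (by omega) (by omega)]
    exact avoidCount_chainPoint_two _ n

theorem firstCounts_chainPoint_extreme {a b c d : ℕ} (h : [a, b, c, d].Perm [1, 2, 3, 4])
    (hd : d = 1 ∨ d = 4) :
    (chainPoint a b c d h).firstCounts = [1, 2, 6, 20, 70, 252, 924, 3432] := by
  simp only [firstCounts, avoidCount_chainPoint_extreme h hd]
  decide +kernel

theorem firstCounts_chainPoint_middle {a b c d : ℕ} (h : [a, b, c, d].Perm [1, 2, 3, 4])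
    (hd : d = 2 ∨ d = 3) :
    (chainPoint a b c d h).firstCounts = [1, 2, 6, 20, 71, 264, 1015, 4002] := by
  simp only [firstCounts, avoidCount_chainPoint_middle h hd]
  decide +kernel

/-! ### Counts for two chains -/

theorem twoChains_dual {a b c d : ℕ} (h : [a, b, c, d].Perm [1, 2, 3, 4])
    (h' : [b, a, d, c].Perm [1, 2, 3, 4]) :
    WilfEquiv (twoChains a b c d h) (twoChains b a d c h') := by
  intro n _
  refine avoidCount_eq_of_dual (fun x y => ?_) n
  simp only [twoChains_lt]
  tauto

theorem alive4_eq_noTail {p : POP 4} {Q : ℕ → ℕ → Prop}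
    (h : ∀ v a b c, p.rel (shift v a) (shift v b) (shift v c) v ↔ b < a ∧ Q c v) :
    Alive4 p.rel = NoTail Q := by
  funext n f v
  simp only [Alive4, NoTail, h]

theorem avoidCount_twoChains_1243 (n : ℕ) : (twoChains 1 2 4 3).avoidCount n = headTree n 0 := by
  rw [avoidCount_eq_desc, alive4_eq_noTail (Q := (· < ·)), desc_noTail_lt_zero]
  intro v a b c
  rw [← shift_lt_shift (v := v), ← shift_lt_self (x := c)]
  simp [rel, twoChains_lt, Fin.forall_fin_succ]

theorem avoidCount_twoChains_1234 (n : ℕ) : (twoChains 1 2 3 4).avoidCount n = headTree n 0 := by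
  rw [avoidCount_eq_desc, alive4_eq_noTail (Q := (· ≥ ·)), desc_noTail_ge_zero]
  intro v a b c
  rw [← shift_lt_shift (v := v), ge_iff_le, ← self_lt_shift (x := c)]
  simp [rel, twoChains_lt, Fin.forall_fin_succ]

theorem firstCounts_twoChains_1243 :
    (twoChains 1 2 4 3).firstCounts = [1, 2, 6, 18, 50, 130, 322, 770] := by
  simp only [firstCounts, avoidCount_twoChains_1243]
  decide +kernel

/-- Of two complementary patterns, this is the one whose last value must be small, as
`avoidCount_eq_listDesc` requires. -/
theorem firstCounts_twoChains_3124 :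
    (twoChains 3 1 2 4).firstCounts = [1, 2, 6, 18, 52, 152, 444, 1296] := by
  have h := avoidCount_eq_listDesc (p := twoChains 3 1 2 4)
    (w := fun a b c => if a < c then b + 1 else 0) fun v a b c => by
      have h1 : (if a < c then b + 1 else 0) = if shift v a < shift v c then b + 1 else 0 := by
        simp only [shift_lt_shift]
      have h2 := self_lt_shift (v := v) (x := b)
      rw [h1]
      simp [rel, twoChains_lt, Fin.forall_fin_succ]
      split_ifs <;> omega
  simp only [firstCounts, h]
  decide +kernel

theorem firstCounts_twoChains_1324 :
    (twoChains 1 3 2 4).firstCounts = [1, 2, 6, 18, 52, 147, 413, 1159] := by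
  have h := avoidCount_eq_listDesc (p := twoChains 1 3 2 4)
    (w := fun a b c => if c < a then b + 1 else 0) fun v a b c => by
      have h1 : (if c < a then b + 1 else 0) = if shift v c < shift v a then b + 1 else 0 := by
        simp only [shift_lt_shift]
      have h2 := self_lt_shift (v := v) (x := b)
      rw [h1]
      simp [rel, twoChains_lt, Fin.forall_fin_succ]
      split_ifs <;> omega
  simp only [firstCounts, h]
  decide +kernel

theorem firstCounts_twoChains_1432 :
    (twoChains 1 4 3 2).firstCounts = [1, 2, 6, 18, 50, 134, 358, 962] := by
  have h := avoidCount_eq_listDesc (p := twoChains 1 4 3 2)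
    (w := fun a b c => if b < c then a + 1 else 0) fun v a b c => by
      have h1 : (if b < c then a + 1 else 0) = if shift v b < shift v c then a + 1 else 0 := by
        simp only [shift_lt_shift]
      have h2 := self_lt_shift (v := v) (x := a)
      rw [h1]
      simp [rel, twoChains_lt, Fin.forall_fin_succ]
      split_ifs <;> omega
  simp only [firstCounts, h]
  decide +kernel

theorem firstCounts_twoChains_1423 :
    (twoChains 1 4 2 3).firstCounts = [1, 2, 6, 18, 53, 156, 460, 1357] := by
  have h := avoidCount_eq_listDesc (p := twoChains 1 4 2 3)
    (w := fun a b c => if c < b then a + 1 else 0) fun v a b c => by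
      have h1 : (if c < b then a + 1 else 0) = if shift v c < shift v b then a + 1 else 0 := by
        simp only [shift_lt_shift]
      have h2 := self_lt_shift (v := v) (x := a)
      rw [h1]
      simp [rel, twoChains_lt, Fin.forall_fin_succ]
      split_ifs <;> omega
  simp only [firstCounts, h]
  decide +kernel

/-! ### The patterns of each type -/

theorem ext_le {k : ℕ} {p q : POP k} (h : ∀ x y, p.order.le x y ↔ q.order.le x y) : p = q := by
  obtain ⟨p⟩ := p
  obtain ⟨q⟩ := q
  congr 1
  exact PartialOrder.ext h

theorem perm_of_ne (A B C D : Fin 4) (h : A ≠ B ∧ A ≠ C ∧ A ≠ D ∧ B ≠ C ∧ B ≠ D ∧ C ≠ D) :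
    [A.val + 1, B.val + 1, C.val + 1, D.val + 1].Perm [1, 2, 3, 4] := by
  revert A B C D
  decide

theorem exists_fin_of_perm {a b c d : ℕ} (h : [a, b, c, d].Perm [1, 2, 3, 4]) :
    ∃ A B C D : Fin 4, a = A.val + 1 ∧ b = B.val + 1 ∧ c = C.val + 1 ∧ d = D.val + 1 ∧
      A ≠ B ∧ A ≠ C ∧ A ≠ D ∧ B ≠ C ∧ B ≠ D ∧ C ≠ D := by
  obtain ⟨ha, hb, hc, hd, h1, h2, h3, h4, h5, h6⟩ := cases_of_perm h
  have key : ∀ x ∈ Icc 1 4, ∃ X : Fin 4, x = X.val + 1 := by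
    intro x hx
    rw [mem_Icc] at hx
    exact ⟨⟨x - 1, by omega⟩, by simp only; omega⟩
  obtain ⟨A, rfl⟩ := key a ha
  obtain ⟨B, rfl⟩ := key b hb
  obtain ⟨C, rfl⟩ := key c hc
  obtain ⟨D, rfl⟩ := key d hd
  refine ⟨A, B, C, D, rfl, rfl, rfl, rfl, ?_, ?_, ?_, ?_, ?_, ?_⟩ <;> rintro rfl <;> contradiction

theorem chainPoint_le {a b c d : ℕ} (h : [a, b, c, d].Perm [1, 2, 3, 4]) (x y : Fin 4) :
    (chainPoint a b c d h).order.le x y ↔ x = y ∨ (x.val + 1 = b ∧ y.val + 1 = a) ∨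
      (x.val + 1 = c ∧ y.val + 1 = b) ∨ (x.val + 1 = c ∧ y.val + 1 = a) := Iff.rfl

theorem twoChains_le {a b c d : ℕ} (h : [a, b, c, d].Perm [1, 2, 3, 4]) (x y : Fin 4) :
    (twoChains a b c d h).order.le x y ↔
      x = y ∨ (x.val + 1 = b ∧ y.val + 1 = a) ∨ (x.val + 1 = d ∧ y.val + 1 = c) := Iff.rfl

theorem nonempty_orderIso_iff {β : Type*} [LE β] (p : POP 4) :
    Nonempty (@OrderIso (Fin 4) β p.order.toLE _) ↔
      ∃ e : β ≃ Fin 4, ∀ s t, s ≤ t ↔ p.order.le (e s) (e t) := by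
  constructor
  · rintro ⟨φ⟩
    refine ⟨(RelIso.toEquiv φ).symm, fun s t => ?_⟩
    obtain ⟨x, rfl⟩ := (RelIso.toEquiv φ).surjective s
    obtain ⟨y, rfl⟩ := (RelIso.toEquiv φ).surjective t
    rw [Equiv.symm_apply_apply, Equiv.symm_apply_apply]
    exact φ.map_rel_iff'
  · rintro ⟨e, h⟩
    exact ⟨⟨e.symm, fun {x y} => by rw [h, e.apply_symm_apply, e.apply_symm_apply]⟩⟩

/-- The images of the summands of `Fin 3 ⊕ Fin 1` are the labels, with `a` the image of the top; the
orders are then compared by a finite check. -/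
theorem mem_typeII_iff (p : POP 4) : p ∈ typeII ↔
    ∃ (a b c d : ℕ) (h : [a, b, c, d].Perm [1, 2, 3, 4]), p = chainPoint a b c d h := by
  refine (nonempty_orderIso_iff p).trans ?_
  constructor
  · rintro ⟨e, he⟩
    have hn : e (Sum.inl 2) ≠ e (Sum.inl 1) ∧ e (Sum.inl 2) ≠ e (Sum.inl 0) ∧
        e (Sum.inl 2) ≠ e (Sum.inr 0) ∧ e (Sum.inl 1) ≠ e (Sum.inl 0) ∧
        e (Sum.inl 1) ≠ e (Sum.inr 0) ∧ e (Sum.inl 0) ≠ e (Sum.inr 0) := by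
      simp only [ne_eq, e.injective.eq_iff]
      decide
    refine ⟨_, _, _, _, perm_of_ne _ _ _ _ hn, ext_le fun x y => ?_⟩
    obtain ⟨s, rfl⟩ := e.surjective x
    obtain ⟨t, rfl⟩ := e.surjective y
    rw [chainPoint_le, ← he]
    simp only [Nat.add_right_cancel_iff, Fin.val_inj, e.injective.eq_iff, Sum.le_def]
    revert s t
    decide
  · rintro ⟨a, b, c, d, h, rfl⟩
    obtain ⟨A, B, C, D, rfl, rfl, rfl, rfl, hn⟩ := exists_fin_of_perm h
    let g : Fin 3 ⊕ Fin 1 → Fin 4 := Sum.elim ![C, B, A] ![D]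
    have hg : Function.Injective g := by
      obtain ⟨h1, h2, h3, h4, h5, h6⟩ := hn
      rintro (s | s) (t | t) hst <;> fin_cases s <;> fin_cases t <;> simp_all [g, eq_comm]
    refine ⟨Equiv.ofBijective g ((Fintype.bijective_iff_injective_and_card g).2 ⟨hg, rfl⟩),
      fun s t => ?_⟩
    have hA : A = g (Sum.inl 2) := rfl
    have hB : B = g (Sum.inl 1) := rfl
    have hC : C = g (Sum.inl 0) := rfl
    simp only [chainPoint_le, Equiv.ofBijective_apply, Nat.add_right_cancel_iff, Fin.val_inj]
    rw [hA, hB, hC]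
    simp only [hg.eq_iff, Sum.le_def]
    revert s t
    decide

theorem mem_typeIII_iff (p : POP 4) : p ∈ typeIII ↔
    ∃ (a b c d : ℕ) (h : [a, b, c, d].Perm [1, 2, 3, 4]), p = twoChains a b c d h := by
  refine (nonempty_orderIso_iff p).trans ?_
  constructor
  · rintro ⟨e, he⟩
    have hn : e (Sum.inl 1) ≠ e (Sum.inl 0) ∧ e (Sum.inl 1) ≠ e (Sum.inr 1) ∧
        e (Sum.inl 1) ≠ e (Sum.inr 0) ∧ e (Sum.inl 0) ≠ e (Sum.inr 1) ∧
        e (Sum.inl 0) ≠ e (Sum.inr 0) ∧ e (Sum.inr 1) ≠ e (Sum.inr 0) := by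
      simp only [ne_eq, e.injective.eq_iff]
      decide
    refine ⟨_, _, _, _, perm_of_ne _ _ _ _ hn, ext_le fun x y => ?_⟩
    obtain ⟨s, rfl⟩ := e.surjective x
    obtain ⟨t, rfl⟩ := e.surjective y
    rw [twoChains_le, ← he]
    simp only [Nat.add_right_cancel_iff, Fin.val_inj, e.injective.eq_iff, Sum.le_def]
    revert s t
    decide
  · rintro ⟨a, b, c, d, h, rfl⟩
    obtain ⟨A, B, C, D, rfl, rfl, rfl, rfl, hn⟩ := exists_fin_of_perm h
    let g : Fin 2 ⊕ Fin 2 → Fin 4 := Sum.elim ![B, A] ![D, C]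
    have hg : Function.Injective g := by
      obtain ⟨h1, h2, h3, h4, h5, h6⟩ := hn
      rintro (s | s) (t | t) hst <;> fin_cases s <;> fin_cases t <;> simp_all [g, eq_comm]
    refine ⟨Equiv.ofBijective g ((Fintype.bijective_iff_injective_and_card g).2 ⟨hg, rfl⟩),
      fun s t => ?_⟩
    have hA : A = g (Sum.inl 1) := rfl
    have hB : B = g (Sum.inl 0) := rfl
    have hC : C = g (Sum.inr 1) := rfl
    have hD : D = g (Sum.inr 0) := rfl
    simp only [twoChains_le, Equiv.ofBijective_apply, Nat.add_right_cancel_iff, Fin.val_inj]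
    rw [hA, hB, hC, hD]
    simp only [hg.eq_iff, Sum.le_def]
    revert s t
    decide

theorem twoChains_swap {a b c d : ℕ} (h : [a, b, c, d].Perm [1, 2, 3, 4])
    (h' : [c, d, a, b].Perm [1, 2, 3, 4]) : twoChains a b c d h = twoChains c d a b h' :=
  ext_le fun x y => by simp only [twoChains_le]; tauto

theorem eq_of_mem_typeIII {p : POP 4} (hp : p ∈ typeIII) :
    (p = twoChains 1 2 4 3 ∨ p = twoChains 1 2 3 4 ∨ p = twoChains 2 1 3 4 ∨
      p = twoChains 2 1 4 3) ∨ (p = twoChains 1 3 4 2 ∨ p = twoChains 3 1 2 4) ∨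
    (p = twoChains 1 3 2 4 ∨ p = twoChains 3 1 4 2) ∨
    (p = twoChains 1 4 3 2 ∨ p = twoChains 4 1 2 3) ∨
    (p = twoChains 1 4 2 3 ∨ p = twoChains 4 1 3 2) := by
  have key : ∀ {a b c d : ℕ} (h : [a, b, c, d].Perm [1, 2, 3, 4]), a = 1 ∨ b = 1 →
      (twoChains a b c d h = twoChains 1 2 4 3 ∨ twoChains a b c d h = twoChains 1 2 3 4 ∨
        twoChains a b c d h = twoChains 2 1 3 4 ∨ twoChains a b c d h = twoChains 2 1 4 3) ∨
      (twoChains a b c d h = twoChains 1 3 4 2 ∨ twoChains a b c d h = twoChains 3 1 2 4) ∨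
      (twoChains a b c d h = twoChains 1 3 2 4 ∨ twoChains a b c d h = twoChains 3 1 4 2) ∨
      (twoChains a b c d h = twoChains 1 4 3 2 ∨ twoChains a b c d h = twoChains 4 1 2 3) ∨
      (twoChains a b c d h = twoChains 1 4 2 3 ∨ twoChains a b c d h = twoChains 4 1 3 2) := by
    intro a b c d h hab
    have h3 : ∀ b ∈ Icc (1 : ℕ) 4, ∀ c ∈ Icc (1 : ℕ) 4, ∀ d ∈ Icc (1 : ℕ) 4,
        1 ≠ b ∧ 1 ≠ c ∧ 1 ≠ d ∧ b ≠ c ∧ b ≠ d ∧ c ≠ d →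
        (b = 2 ∧ c = 3 ∧ d = 4) ∨ (b = 2 ∧ c = 4 ∧ d = 3) ∨ (b = 3 ∧ c = 2 ∧ d = 4) ∨
        (b = 3 ∧ c = 4 ∧ d = 2) ∨ (b = 4 ∧ c = 2 ∧ d = 3) ∨ (b = 4 ∧ c = 3 ∧ d = 2) := by decide
    obtain ⟨ha, hb, hc, hd, h12, h13, h14, h23, h24, h34⟩ := cases_of_perm h
    rcases hab with rfl | rfl
    · rcases h3 b hb c hc d hd ⟨h12, h13, h14, h23, h24, h34⟩ with ⟨rfl, rfl, rfl⟩ |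
        ⟨rfl, rfl, rfl⟩ | ⟨rfl, rfl, rfl⟩ | ⟨rfl, rfl, rfl⟩ | ⟨rfl, rfl, rfl⟩ | ⟨rfl, rfl, rfl⟩ <;>
        simp only [true_or, or_true]
    · rcases h3 a ha c hc d hd ⟨h12.symm, h23, h24, h13, h14, h34⟩ with ⟨rfl, rfl, rfl⟩ |
        ⟨rfl, rfl, rfl⟩ | ⟨rfl, rfl, rfl⟩ | ⟨rfl, rfl, rfl⟩ | ⟨rfl, rfl, rfl⟩ | ⟨rfl, rfl, rfl⟩ <;>
        simp only [true_or, or_true]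
  obtain ⟨a, b, c, d, h, rfl⟩ := (mem_typeIII_iff p).1 hp
  have h1 : 1 ∈ [a, b, c, d] := h.mem_iff.2 (by decide)
  simp only [List.mem_cons, List.not_mem_nil, or_false] at h1
  by_cases hab : a = 1 ∨ b = 1
  · exact key h hab
  -- The two chains are exchanged so that label 1 lies in the first.
  · rw [twoChains_swap h (List.perm_append_comm (l₁ := [c, d]) (l₂ := [a, b]) |>.trans h)]
    exact key _ (by tauto)

/-! ### Wilf classes -/

theorem avoidCount_six_of_firstCounts {k : ℕ} {p : POP k} {a b c d e x y z : ℕ}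
    (h : p.firstCounts = [a, b, c, d, e, x, y, z]) : p.avoidCount 6 = x := by
  simp [firstCounts, List.range_succ] at h
  exact h.2.2.2.2.2.1

theorem chainPoint_mem_typeII {a b c d : ℕ} (h : [a, b, c, d].Perm [1, 2, 3, 4]) :
    chainPoint a b c d h ∈ typeII := (mem_typeII_iff _).2 ⟨a, b, c, d, h, rfl⟩

theorem twoChains_mem_typeIII {a b c d : ℕ} (h : [a, b, c, d].Perm [1, 2, 3, 4]) :
    twoChains a b c d h ∈ typeIII := (mem_typeIII_iff _).2 ⟨a, b, c, d, h, rfl⟩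

theorem extreme_or_middle {a b c d : ℕ} (h : [a, b, c, d].Perm [1, 2, 3, 4]) :
    (d = 1 ∨ d = 4) ∨ (d = 2 ∨ d = 3) := by
  have h1 : d ∈ [1, 2, 3, 4] := h.mem_iff.1 (by simp)
  simp only [List.mem_cons, List.not_mem_nil, or_false] at h1
  omega

theorem wilfEquiv_chainPoint_iff {a b c d a' b' c' d' : ℕ} (h : [a, b, c, d].Perm [1, 2, 3, 4])
    (h' : [a', b', c', d'].Perm [1, 2, 3, 4]) :
    WilfEquiv (chainPoint a b c d h) (chainPoint a' b' c' d' h') ↔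
      ((d = 1 ∨ d = 4) ↔ (d' = 1 ∨ d' = 4)) := by
  rcases extreme_or_middle h with hd | hd <;> rcases extreme_or_middle h' with hd' | hd'
  · refine iff_of_true (fun n hn => ?_) (iff_of_true hd hd')
    obtain ⟨n, rfl⟩ : ∃ m, n = m + 1 := ⟨n - 1, by omega⟩
    rw [avoidCount_chainPoint_extreme h hd, avoidCount_chainPoint_extreme h' hd']
  · refine iff_of_false (fun hw => ?_) (by omega)
    have := hw 6 (by omega)
    rw [avoidCount_six_of_firstCounts (firstCounts_chainPoint_extreme h hd),
      avoidCount_six_of_firstCounts (firstCounts_chainPoint_middle h' hd')] at this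
    omega
  · refine iff_of_false (fun hw => ?_) (by omega)
    have := hw 6 (by omega)
    rw [avoidCount_six_of_firstCounts (firstCounts_chainPoint_middle h hd),
      avoidCount_six_of_firstCounts (firstCounts_chainPoint_extreme h' hd')] at this
    omega
  · refine iff_of_true (fun n hn => ?_) (by omega)
    obtain ⟨n, rfl⟩ : ∃ m, n = m + 1 := ⟨n - 1, by omega⟩
    rw [avoidCount_chainPoint_middle h hd, avoidCount_chainPoint_middle h' hd']

theorem mk_eq_mk_iff {k : ℕ} {p q : POP k} :
    Quotient.mk (wilfSetoid k) p = Quotient.mk (wilfSetoid k) q ↔ WilfEquiv p q :=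
  Quotient.eq

theorem numWilfClasses_typeII : numWilfClasses typeII = 2 := by
  have h : Quotient.mk (wilfSetoid 4) '' typeII =
      {Quotient.mk (wilfSetoid 4) (chainPoint 3 2 1 4),
        Quotient.mk (wilfSetoid 4) (chainPoint 4 3 1 2)} := by
    ext x
    constructor
    · rintro ⟨p, hp, rfl⟩
      obtain ⟨a, b, c, d, h, rfl⟩ := (mem_typeII_iff p).1 hp
      rcases extreme_or_middle h with hd | hd
      · left
        rw [mk_eq_mk_iff, wilfEquiv_chainPoint_iff]
        omega
      · right
        rw [Set.mem_singleton_iff, mk_eq_mk_iff, wilfEquiv_chainPoint_iff]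
        omega
    · rintro (rfl | rfl)
      · exact ⟨_, chainPoint_mem_typeII _, rfl⟩
      · exact ⟨_, chainPoint_mem_typeII _, rfl⟩
  rw [numWilfClasses, h, Set.ncard_pair]
  rw [Ne, mk_eq_mk_iff, wilfEquiv_chainPoint_iff]
  omega

theorem WilfEquiv.trans {k l m : ℕ} {p : POP k} {q : POP l} {r : POP m} (h : WilfEquiv p q)
    (h' : WilfEquiv q r) : WilfEquiv p r :=
  fun n hn => (h n hn).trans (h' n hn)

theorem wilfEquiv_1234 : WilfEquiv (twoChains 1 2 3 4) (twoChains 1 2 4 3) := fun n _ => by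
  rw [avoidCount_twoChains_1234, avoidCount_twoChains_1243]

theorem wilfEquiv_of_eq_1243 {p : POP 4} (h : p = twoChains 1 2 4 3 ∨ p = twoChains 1 2 3 4 ∨
    p = twoChains 2 1 3 4 ∨ p = twoChains 2 1 4 3) : WilfEquiv p (twoChains 1 2 4 3) := by
  rcases h with rfl | rfl | rfl | rfl
  · exact fun _ _ => rfl
  · exact wilfEquiv_1234
  · exact twoChains_dual _ _
  · exact (twoChains_dual _ (by decide)).trans wilfEquiv_1234

theorem wilfEquiv_of_eq {a b c d : ℕ} {h : [a, b, c, d].Perm [1, 2, 3, 4]}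
    {h' : [b, a, d, c].Perm [1, 2, 3, 4]} {p : POP 4}
    (hp : p = twoChains a b c d h ∨ p = twoChains b a d c h') :
    WilfEquiv p (twoChains a b c d h) := by
  rcases hp with rfl | rfl
  · exact fun _ _ => rfl
  · exact twoChains_dual _ _

theorem firstCounts_twoChains_1342 :
    (twoChains 1 3 4 2).firstCounts = [1, 2, 6, 18, 52, 152, 444, 1296] := by
  rw [← firstCounts_twoChains_3124]
  refine List.map_congr_left fun i _ => ?_
  exact twoChains_dual _ _ (i + 1) (by omega)

/-- The counts at size 6 are 130, 152, 147, 134 and 156, all distinct, so an equivalence forces the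
class. -/
theorem wilfEquiv_class_iff {p : POP 4} (hp : p ∈ typeIII) :
    (WilfEquiv p (twoChains 1 2 4 3) ↔ p = twoChains 1 2 4 3 ∨ p = twoChains 1 2 3 4 ∨
      p = twoChains 2 1 3 4 ∨ p = twoChains 2 1 4 3) ∧
    (WilfEquiv p (twoChains 1 3 4 2) ↔ p = twoChains 1 3 4 2 ∨ p = twoChains 3 1 2 4) ∧
    (WilfEquiv p (twoChains 1 3 2 4) ↔ p = twoChains 1 3 2 4 ∨ p = twoChains 3 1 4 2) ∧
    (WilfEquiv p (twoChains 1 4 3 2) ↔ p = twoChains 1 4 3 2 ∨ p = twoChains 4 1 2 3) ∧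
    (WilfEquiv p (twoChains 1 4 2 3) ↔ p = twoChains 1 4 2 3 ∨ p = twoChains 4 1 3 2) := by
  have c1 := avoidCount_six_of_firstCounts firstCounts_twoChains_1243
  have c2 := avoidCount_six_of_firstCounts firstCounts_twoChains_1342
  have c3 := avoidCount_six_of_firstCounts firstCounts_twoChains_1324
  have c4 := avoidCount_six_of_firstCounts firstCounts_twoChains_1432
  have c5 := avoidCount_six_of_firstCounts firstCounts_twoChains_1423
  have hw : ∀ q : POP 4, WilfEquiv p q → p.avoidCount 6 = q.avoidCount 6 :=
    fun q h => h 6 (by omega)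
  have e1 := wilfEquiv_of_eq_1243 (p := p)
  have e2 := wilfEquiv_of_eq (h := (by decide : [1, 3, 4, 2].Perm [1, 2, 3, 4]))
    (h' := by decide) (p := p)
  have e3 := wilfEquiv_of_eq (h := (by decide : [1, 3, 2, 4].Perm [1, 2, 3, 4]))
    (h' := by decide) (p := p)
  have e4 := wilfEquiv_of_eq (h := (by decide : [1, 4, 3, 2].Perm [1, 2, 3, 4]))
    (h' := by decide) (p := p)
  have e5 := wilfEquiv_of_eq (h := (by decide : [1, 4, 2, 3].Perm [1, 2, 3, 4]))
    (h' := by decide) (p := p)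
  have w1 := hw (twoChains 1 2 4 3)
  have w2 := hw (twoChains 1 3 4 2)
  have w3 := hw (twoChains 1 3 2 4)
  have w4 := hw (twoChains 1 4 3 2)
  have w5 := hw (twoChains 1 4 2 3)
  rw [c1] at w1
  rw [c2] at w2
  rw [c3] at w3
  rw [c4] at w4
  rw [c5] at w5
  have hall := eq_of_mem_typeIII hp
  -- With the five alternatives and the count made opaque, only propositional logic and arithmetic
  -- remain.
  generalize (p = twoChains 1 2 4 3 ∨ p = twoChains 1 2 3 4 ∨
      p = twoChains 2 1 3 4 ∨ p = twoChains 2 1 4 3) = E1 at *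
  generalize (p = twoChains 1 3 4 2 ∨ p = twoChains 3 1 2 4) = E2 at *
  generalize (p = twoChains 1 3 2 4 ∨ p = twoChains 3 1 4 2) = E3 at *
  generalize (p = twoChains 1 4 3 2 ∨ p = twoChains 4 1 2 3) = E4 at *
  generalize (p = twoChains 1 4 2 3 ∨ p = twoChains 4 1 3 2) = E5 at *
  generalize p.avoidCount 6 = x at *
  rcases hall.imp (fun h => And.intro h (w1 (e1 h))) (Or.imp (fun h => And.intro h (w2 (e2 h)))
    (Or.imp (fun h => And.intro h (w3 (e3 h))) (Or.imp (fun h => And.intro h (w4 (e4 h)))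
    (fun h => And.intro h (w5 (e5 h)))))) with ⟨h, hx⟩ | ⟨h, hx⟩ | ⟨h, hx⟩ | ⟨h, hx⟩ | ⟨h, hx⟩
  all_goals
    refine ⟨⟨fun k => ?_, e1⟩, ⟨fun k => ?_, e2⟩, ⟨fun k => ?_, e3⟩, ⟨fun k => ?_, e4⟩,
      ⟨fun k => ?_, e5⟩⟩
  all_goals first
    | exact h
    | exact absurd (w1 k) (by omega)
    | exact absurd (w2 k) (by omega)
    | exact absurd (w3 k) (by omega)
    | exact absurd (w4 k) (by omega)
    | exact absurd (w5 k) (by omega)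

theorem numWilfClasses_typeIII : numWilfClasses typeIII = 5 := by
  have h : Quotient.mk (wilfSetoid 4) '' typeIII =
      {Quotient.mk (wilfSetoid 4) (twoChains 1 2 4 3),
        Quotient.mk (wilfSetoid 4) (twoChains 1 3 4 2),
        Quotient.mk (wilfSetoid 4) (twoChains 1 3 2 4),
        Quotient.mk (wilfSetoid 4) (twoChains 1 4 3 2),
        Quotient.mk (wilfSetoid 4) (twoChains 1 4 2 3)} := by
    ext x
    simp only [Set.mem_insert_iff, Set.mem_singleton_iff]
    constructor
    · rintro ⟨p, hp, rfl⟩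
      obtain ⟨h1, h2, h3, h4, h5⟩ := wilfEquiv_class_iff hp
      simp only [mk_eq_mk_iff]
      rw [h1, h2, h3, h4, h5]
      exact eq_of_mem_typeIII hp
    · rintro (rfl | rfl | rfl | rfl | rfl) <;> exact ⟨_, twoChains_mem_typeIII _, rfl⟩
  have hne : ∀ {p q : POP 4} {x y : ℕ}, p.avoidCount 6 = x → q.avoidCount 6 = y → x ≠ y →
      Quotient.mk (wilfSetoid 4) p ≠ Quotient.mk (wilfSetoid 4) q := by
    rintro p q x y rfl rfl hxy he
    exact hxy (mk_eq_mk_iff.1 he 6 (by omega))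
  have c1 := avoidCount_six_of_firstCounts firstCounts_twoChains_1243
  have c2 := avoidCount_six_of_firstCounts firstCounts_twoChains_1342
  have c3 := avoidCount_six_of_firstCounts firstCounts_twoChains_1324
  have c4 := avoidCount_six_of_firstCounts firstCounts_twoChains_1432
  have c5 := avoidCount_six_of_firstCounts firstCounts_twoChains_1423
  rw [numWilfClasses, h, Set.ncard_insert_of_notMem, Set.ncard_insert_of_notMem,
    Set.ncard_insert_of_notMem, Set.ncard_pair (hne c4 c5 (by omega))]
  · simp only [Set.mem_insert_iff, Set.mem_singleton_iff, not_or]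
    exact ⟨hne c3 c4 (by omega), hne c3 c5 (by omega)⟩
  · simp only [Set.mem_insert_iff, Set.mem_singleton_iff, not_or]
    exact ⟨hne c2 c3 (by omega), hne c2 c4 (by omega), hne c2 c5 (by omega)⟩
  · simp only [Set.mem_insert_iff, Set.mem_singleton_iff, not_or]
    exact ⟨hne c1 c2 (by omega), hne c1 c3 (by omega), hne c1 c4 (by omega),
      hne c1 c5 (by omega)⟩

end POP

open POP in
theorem mainTheorem8 :
    -- 3-chain and isolated vertex: every such pattern is some `(a, b, c; d)`
    ((∀ p : POP 4, p ∈ typeII ↔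
        ∃ (a b c d : ℕ) (h : [a, b, c, d].Perm [1, 2, 3, 4]), p = chainPoint a b c d h) ∧
      numWilfClasses typeII = 2 ∧
      -- the class is determined by whether the label of the isolated vertex is extreme
      (∀ (a b c d a' b' c' d' : ℕ) (h : [a, b, c, d].Perm [1, 2, 3, 4])
          (h' : [a', b', c', d'].Perm [1, 2, 3, 4]),
        WilfEquiv (chainPoint a b c d h) (chainPoint a' b' c' d' h') ↔
          ((d = 1 ∨ d = 4) ↔ (d' = 1 ∨ d' = 4))) ∧
      (∀ (a b c d : ℕ) (h : [a, b, c, d].Perm [1, 2, 3, 4]), d = 1 ∨ d = 4 →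
        (∀ n : ℕ, 1 ≤ n → (chainPoint a b c d h).avoidCount n = Nat.centralBinom (n - 1)) ∧
        (chainPoint a b c d h).firstCounts = [1, 2, 6, 20, 70, 252, 924, 3432]) ∧
      (∃! B : PowerSeries ℤ, IsRevertSeries B) ∧
      (∀ (a b c d : ℕ) (h : [a, b, c, d].Perm [1, 2, 3, 4]), d = 2 ∨ d = 3 →
        (∀ B : PowerSeries ℤ, IsRevertSeries B → ∀ n : ℕ, 1 ≤ n →
          ((chainPoint a b c d h).avoidCount n : ℤ) = PowerSeries.coeff (n + 1) B) ∧
        (chainPoint a b c d h).firstCounts = [1, 2, 6, 20, 71, 264, 1015, 4002])) ∧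
    -- two 2-chains: every such pattern is some `(a, b; c, d)`
    ((∀ p : POP 4, p ∈ typeIII ↔
        ∃ (a b c d : ℕ) (h : [a, b, c, d].Perm [1, 2, 3, 4]), p = twoChains a b c d h) ∧
      numWilfClasses typeIII = 5 ∧
      (∀ p ∈ typeIII,
        (WilfEquiv p (twoChains 1 2 4 3) ↔ p = twoChains 1 2 4 3 ∨ p = twoChains 1 2 3 4 ∨
          p = twoChains 2 1 3 4 ∨ p = twoChains 2 1 4 3) ∧
        (WilfEquiv p (twoChains 1 3 4 2) ↔ p = twoChains 1 3 4 2 ∨ p = twoChains 3 1 2 4) ∧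
        (WilfEquiv p (twoChains 1 3 2 4) ↔ p = twoChains 1 3 2 4 ∨ p = twoChains 3 1 4 2) ∧
        (WilfEquiv p (twoChains 1 4 3 2) ↔ p = twoChains 1 4 3 2 ∨ p = twoChains 4 1 2 3) ∧
        (WilfEquiv p (twoChains 1 4 2 3) ↔ p = twoChains 1 4 2 3 ∨ p = twoChains 4 1 3 2)) ∧
      (twoChains 1 2 4 3).firstCounts = [1, 2, 6, 18, 50, 130, 322, 770] ∧
      (twoChains 1 3 4 2).firstCounts = [1, 2, 6, 18, 52, 152, 444, 1296] ∧
      (twoChains 1 3 2 4).firstCounts = [1, 2, 6, 18, 52, 147, 413, 1159] ∧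
      (twoChains 1 4 3 2).firstCounts = [1, 2, 6, 18, 50, 134, 358, 962] ∧
      (twoChains 1 4 2 3).firstCounts = [1, 2, 6, 18, 53, 156, 460, 1357]) := by
  refine ⟨⟨mem_typeII_iff, numWilfClasses_typeII, fun _ _ _ _ _ _ _ _ h h' =>
    wilfEquiv_chainPoint_iff h h', fun a b c d h hd => ⟨fun n hn => ?_,
    firstCounts_chainPoint_extreme h hd⟩, existsUnique_revertSeries, fun a b c d h hd =>
    ⟨fun B hB n hn => ?_, firstCounts_chainPoint_middle h hd⟩⟩, mem_typeIII_iff,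
    numWilfClasses_typeIII, fun p hp => wilfEquiv_class_iff hp, firstCounts_twoChains_1243,
    firstCounts_twoChains_1342, firstCounts_twoChains_1324, firstCounts_twoChains_1432,
    firstCounts_twoChains_1423⟩
  · obtain ⟨n, rfl⟩ : ∃ m, n = m + 1 := ⟨n - 1, by omega⟩
    exact avoidCount_chainPoint_extreme h hd n
  · obtain ⟨n, rfl⟩ : ∃ m, n = m + 1 := ⟨n - 1, by omega⟩
    rw [avoidCount_chainPoint_middle h hd]
    exact gapTree_eq_coeff_revert hB n
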